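/- Let $\mathcal X,\mathcal Y$ be nonempty countable alphabets. An input process is a probability measure $X$ on $\mathcal X^{\mathbb Z}$. A channel is a Markov kernel $x\mapsto P(\cdot\mid x)$ from $\mathcal X^{\mathbb Z}$ to $\mathcal Y^{\mathbb Z}$. It is stationary if it commutes with the shift. It is causal if for all $t\in\mathbb Z$, $L\ge 0$ the law of $Y_{t:t+L}=(Y_t,\dots,Y_{t+L-1})$ under $P(\cdot\mid x)$ depends only on $(x_s)_{s<t+L}$. Driving the channel by $X$ gives the joint law of $(X_t,Y_t)_{t\in\mathbb Z}$. Write $\overleftarrow{x}$ for $(x_s)_{s<0}$ and $\overrightarrow{x}$ for $(x_s)_{s\ge 0}$, and similarly for $Y$; a joint past is a pair $(\overleftarrow x,\overleftarrow y)$. For a causal channel put, for words $w$ of length $L$, $$P(Y_{0:L}=w\mid \overrightarrow{x},(\overleftarrow{x},\overleftarrow{y}))=\limsup_{n\to\infty}\frac{P(Y_{-n:0}=y_{-n:0},\,Y_{0:L}=w\mid x)}{P(Y_{-n:0}=y_{-n:0}\mid x)}$$ with $0/0=0$ (for each input $x$ and almost every $\overleftarrow y$ this is a limit, and a version of the conditional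 probability). Two joint pasts are causally equivalent if these numbers agree for every future input $\overrightarrow x$, every $L$ and every $w$; the classes are the causal states. For a partition $\mathcal R$ of the set of joint pasts, let $R$ be the class of the random joint past; a set of classes is measurable if its union is. For an input process $X$ let $C_X(\mathcal R)=\mathrm H[R]\in[0,\infty]$ be the Shannon entropy of the law of $R$, i.e. the supremum of the entropies of its finite measurable coarse-grainings. The channel complexity of $\mathcal R$ is $\overline C(\mathcal R)=\sup_X C_X(\mathcal R)$, over all stationary input processes $X$. The partition $\mathcal R$ is prescient if $$\mathrm I[R;\overrightarrow{Y}\mid\overrightarrow{X}]=\mathrm I[(\overleftarrow{X},\overleftarrow{Y});\overrightarrow{Y}\mid\overrightarrow{X}]\in[0,\infty]$$ for every input process that is stationary up to time $0$, i.e. for which $(X_{-1},X_{-2},\dots)$ and $(X_{-2},X_{-3},\dots)$ have the same law, the future input being arbitrary. Then, for every stationary causal channel, the causal states minimize the channel complexity among all prescient partitions: the partition $\mathcal S$ into causal states is prescient, and $\overline C(\mathcal S)\le\overline C(\mathcal R)$ for every prescient partition $\mathcal R$ of the joint pasts. -/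

import Mathlib

open MeasureTheory ProbabilityTheory Filter
open scoped ENNReal

namespace Transducer

noncomputable section

/-! ### Sequences

The past of a bi-infinite sequence `x` at time `0` is read backwards:
`past x = (x₋₁, x₋₂, …)`, and its future is `future x = (x₀, x₁, …)`. -/

/-- Translation by one time step. -/
def shift {A : Type*} (x : ℤ → A) : ℤ → A := fun t => x (t + 1)

/-- `past x k = x (-(k + 1))`. -/
def past {A : Type*} (x : ℤ → A) : ℕ → A := fun k => x (Int.negSucc k)

/-- `future x k = x k`. -/
def future {A : Type*} (x : ℤ → A) : ℕ → A := fun k => x (Int.ofNat k)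

/-- The bi-infinite sequence with past `p` and future `f`. -/
def glue {A : Type*} (p f : ℕ → A) : ℤ → A
  | Int.ofNat k => f k
  | Int.negSucc k => p k

/-- Joint input-output pasts. -/
abbrev JointPast (A B : Type*) := (ℕ → A) × (ℕ → B)

/-- The joint past at time `0` of a pair (input sequence, output sequence). -/
def jointPast {A B : Type*} (ω : (ℤ → A) × (ℤ → B)) : JointPast A B := (past ω.1, past ω.2)

/-! ### Entropy -/

/-- Shannon entropy, in bits, of a probability distribution `ν` on a measurable space: the supremum
of the Shannon entropies of its finite measurable coarse-grainings. For a discrete distribution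
this is `∑ - ν {s} log₂ (ν {s})`; it is `∞` if `ν` is not discrete. -/
def shannonEntropy {S : Type*} [MeasurableSpace S] (ν : Measure S) : ℝ≥0∞ :=
  ⨆ (n : ℕ) (g : {g : S → Fin n // Measurable g}),
    ∑ i, ENNReal.ofReal (Real.negMulLog (ν.real (g.1 ⁻¹' {i})) / Real.log 2)

variable {A B : Type*} [MeasurableSpace A] [MeasurableSpace B]

/-! ### Processes and channels

An input process over the alphabet `A` is a probability measure on `ℤ → A`. A (total) channel with
input alphabet `A` and output alphabet `B` is a Markov kernel from `ℤ → A` to `ℤ → B`. -/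

/-- A process is stationary if its law is invariant under time translation. -/
def IsStationaryProcess (X : ProbabilityMeasure (ℤ → A)) : Prop :=
  (X : Measure (ℤ → A)).map shift = X

/-- A process is stationary up to time `0` if the past at time `-1` has the law of the past at
time `0`; nothing is required of the future. -/
def IsStationaryPast (X : ProbabilityMeasure (ℤ → A)) : Prop :=
  (X : Measure (ℤ → A)).map (fun x k => past x (k + 1)) = (X : Measure (ℤ → A)).map past

/-- A channel is stationary if it commutes with time translation. -/
def IsStationaryChannel (κ : Kernel (ℤ → A) (ℤ → B)) : Prop :=
  ∀ x, κ (shift x) = (κ x).map shift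

/-- A channel is causal if the law of each output word `Y_t … Y_{t+L-1}` depends only on the
inputs before time `t + L`. -/
def IsCausalChannel (κ : Kernel (ℤ → A) (ℤ → B)) : Prop :=
  ∀ (t : ℤ) (L : ℕ) (x x' : ℤ → A), (∀ s < t + L, x s = x' s) →
    (κ x).map (fun y (i : Fin L) => y (t + (i : ℕ))) =
      (κ x').map (fun y (i : Fin L) => y (t + (i : ℕ)))

/-- The joint law of input and output when the channel `κ` is driven by the input process `X`. -/
def jointProcess (κ : Kernel (ℤ → A) (ℤ → B)) (X : ProbabilityMeasure (ℤ → A)) :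
    Measure ((ℤ → A) × (ℤ → B)) :=
  (X : Measure (ℤ → A)) ⊗ₘ κ

instance (κ : Kernel (ℤ → A) (ℤ → B)) [IsMarkovKernel κ] (X : ProbabilityMeasure (ℤ → A)) :
    IsProbabilityMeasure (jointProcess κ X) := by
  unfold jointProcess; infer_instance

/-! ### Causal states -/

/-- The set of output sequences whose last `n` symbols before time `0` agree with the past `p` and
whose `L` symbols from time `0` on agree with `w`. -/
def cylinder (p : ℕ → B) (n : ℕ) (w : ℕ → B) (L : ℕ) : Set (ℤ → B) :=
  {y | (∀ k < n, past y k = p k) ∧ ∀ k < L, future y k = w k}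

/-- The conditional word probability
`P (Y_{0:L} = w_{0:L} | future input = u, joint past = z)` of the channel. It is the limit, as
`n → ∞`, of the elementary conditional probabilities given the last `n` output symbols (and the
whole input). The limit exists for almost every output past, and is then a version of the
conditional probability; the upper limit makes the function total. -/
def futureMorph (κ : Kernel (ℤ → A) (ℤ → B)) (z : JointPast A B) (u : ℕ → A)
    (w : ℕ → B) (L : ℕ) : ℝ≥0∞ :=
  limsup (fun n : ℕ =>
    κ (glue z.1 u) (cylinder z.2 n w L) / κ (glue z.1 u) (cylinder z.2 n w 0)) atTop

/-- Causal equivalence of joint pasts: the same conditional law of the future output, given any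
future input. The causal states are the equivalence classes. -/
def causalEquiv (κ : Kernel (ℤ → A) (ℤ → B)) : Setoid (JointPast A B) where
  r z z' := ∀ (u : ℕ → A) (w : ℕ → B) (L : ℕ), futureMorph κ z u w L = futureMorph κ z' u w L
  iseqv := ⟨fun _ _ _ _ => rfl, fun h u w L => (h u w L).symm,
    fun h h' u w L => (h u w L).trans (h' u w L)⟩

/-! ### Rival partitions

A partition of the joint pasts is a `Setoid`. Its set of states is the quotient, with the quotient
σ-algebra: a set of states is measurable if the set of pasts in these states is. -/

/-- The statistical complexity `C_X`: the Shannon entropy of the distribution that the input process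
`X` induces on the states of the partition `r`. -/
def statComplexity (κ : Kernel (ℤ → A) (ℤ → B)) (X : ProbabilityMeasure (ℤ → A))
    (r : Setoid (JointPast A B)) : ℝ≥0∞ :=
  shannonEntropy ((jointProcess κ X).map (fun ω => Quotient.mk r (jointPast ω)))

/-- The channel complexity: the supremum of `C_X` over all stationary input processes `X`. -/
def channelComplexity (κ : Kernel (ℤ → A) (ℤ → B)) (r : Setoid (JointPast A B)) : ℝ≥0∞ :=
  ⨆ (X : ProbabilityMeasure (ℤ → A)) (_ : IsStationaryProcess X), statComplexity κ X r

variable [Countable A] [DiscreteMeasurableSpace A] [Nonempty A]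
  [Countable B] [DiscreteMeasurableSpace B] [Nonempty B]

/-- The conditional mutual information `I[R ; Y⁺ | X⁺]`, where `R = η (joint past)` and `Y⁺`, `X⁺`
are the future output and the future input: the Kullback-Leibler divergence of the joint law of
`(X⁺, R, Y⁺)` from the law under which `R` and `Y⁺` are independent given `X⁺`, with the same
conditional laws given `X⁺`. -/
def prescience (κ : Kernel (ℤ → A) (ℤ → B)) [IsMarkovKernel κ] (X : ProbabilityMeasure (ℤ → A))
    {S : Type*} [MeasurableSpace S] (η : JointPast A B → S) : ℝ≥0∞ :=
  InformationTheory.klDiv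
    ((jointProcess κ X).map (fun ω => (future ω.1, (η (jointPast ω), future ω.2))))
    ((jointProcess κ X).map (fun ω => future ω.1) ⊗ₘ
      (((condDistrib jointPast (fun ω => future ω.1) (jointProcess κ X)).map η) ×ₖ
        condDistrib (fun ω => future ω.2) (fun ω => future ω.1) (jointProcess κ X)))

/-- A partition of the joint pasts is prescient if its states share as much information with the
future output, given the future input, as the joint pasts themselves:
`I[R ; Y⁺ | X⁺] = I[joint past ; Y⁺ | X⁺]`, for every input that is stationary up to time `0`,
whatever the future input is. -/
def IsPrescient (κ : Kernel (ℤ → A) (ℤ → B)) [IsMarkovKernel κ]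
    (r : Setoid (JointPast A B)) : Prop :=
  ∀ X : ProbabilityMeasure (ℤ → A), IsStationaryPast X →
    prescience κ X (Quotient.mk r) = prescience κ X (id : JointPast A B → JointPast A B)

end

end Transducer

/-! By Lévy's upward theorem the futures morph is a version of the conditional law of the future
output given the future input and the joint past (`setLIntegral_futureMorph`). Prescience compares
two divergences: that of `tripleLaw` from `refLaw`, and that of their images under the map which
replaces the joint past by its state. Prescience is thus equality in the data processing inequality.
Equality holds if the density factors through the state, and, when the divergence is finite, only
then. A density factors in this way when the futures morph is a function of future input and state,
which is the case for the causal states (`prescience_eq_of_factors`).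

For a rival partition with state `R`, equality is empty where both sides are infinite. But only an
`R` of finite entropy has to be treated, and the future input is free. Keep the past of a stationary
input `X` and continue it by an independent future of law `ρ`. By causality the law of the joint
past is unchanged, hence so are both entropies. As `R` is now independent of the future input, its
conditional information with the future output equals its information with the pair of futures,
which is finite because `R` has finite entropy (`klDiv_prod_ne_top`). So the futures morph is almost
surely a function of future input and `R` (`exists_factor_of_prescience_eq`).

By causality the first `L` input symbols determine the probabilities of output words of length `L`,
so countably many numbers determine the causal state. Choosing `ρ` to charge every padded input word
makes each of them almost surely a function of `R`. Then the causal state has at most the entropy of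
`R` (`shannonEntropy_map_le_of_ae_eq`). This holds for every stationary `X`, hence for the suprema.
-/

namespace Transducer

open InformationTheory

/-! ### Kullback-Leibler divergence and sufficiency -/

section KL

variable {α β : Type*} [MeasurableSpace α] [MeasurableSpace β]

lemma map_withDensity_comp {ν : Measure α} {T : α → β} (hT : Measurable T) {g : β → ℝ≥0∞}
    (hg : Measurable g) : (ν.withDensity (g ∘ T)).map T = (ν.map T).withDensity g := by
  ext s hs
  rw [Measure.map_apply hT hs, withDensity_apply _ (hT hs), withDensity_apply _ hs,
    setLIntegral_map hs hg hT]
  rfl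

/-- If the density of `μ` factors through `T`, then `T` is sufficient. -/
lemma klDiv_map_eq_of_withDensity {μ ν : Measure α} [IsFiniteMeasure μ] [IsFiniteMeasure ν]
    {T : α → β} (hT : Measurable T) {g : β → ℝ≥0∞} (hg : Measurable g)
    (h : μ = ν.withDensity (g ∘ T)) : klDiv (μ.map T) (ν.map T) = klDiv μ ν := by
  have hμT : μ.map T = (ν.map T).withDensity g := by rw [h, map_withDensity_comp hT hg]
  have hac : μ ≪ ν := h ▸ withDensity_absolutelyContinuous _ _
  have h1 : μ.rnDeriv ν =ᵐ[ν] g ∘ T := by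
    rw [h]; exact Measure.rnDeriv_withDensity ν (hg.comp hT)
  have h2 : (μ.map T).rnDeriv (ν.map T) =ᵐ[ν.map T] g := by
    rw [hμT]; exact Measure.rnDeriv_withDensity _ hg
  rw [klDiv_eq_lintegral_klFun_of_ac hac, klDiv_eq_lintegral_klFun_of_ac (hac.map hT),
    lintegral_congr_ae (h1.mono fun x hx => by rw [hx]),
    lintegral_congr_ae (h2.mono fun x hx => by rw [hx]), lintegral_map _ hT]
  · rfl
  · exact (measurable_klFun.comp hg.ennreal_toReal).ennreal_ofReal

lemma klDiv_map_measurableEquiv (μ ν : Measure α) [IsFiniteMeasure μ] [IsFiniteMeasure ν]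
    (e : α ≃ᵐ β) : klDiv (μ.map e) (ν.map e) = klDiv μ ν := by
  refine le_antisymm (klDiv_map_le _ _ e.measurable) ?_
  conv_lhs => rw [← MeasurableEquiv.map_symm_map (μ := μ) e,
    ← MeasurableEquiv.map_symm_map (μ := ν) e]
  exact klDiv_map_le _ _ e.symm.measurable

/-- Equality in the data processing inequality, for a finite divergence. -/
lemma eq_withDensity_of_klDiv_map_eq {μ ν : Measure α} [IsProbabilityMeasure μ]
    [IsProbabilityMeasure ν] {T : α → β} (hT : Measurable T)
    (h : klDiv (μ.map T) (ν.map T) = klDiv μ ν) (hfin : klDiv μ ν ≠ ∞) :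
    μ = ν.withDensity ((μ.map T).rnDeriv (ν.map T) ∘ T) := by
  have := Measure.isProbabilityMeasure_map (μ := μ) hT.aemeasurable
  have := Measure.isProbabilityMeasure_map (μ := ν) hT.aemeasurable
  obtain ⟨hac, hint⟩ := klDiv_ne_top_iff.1 hfin
  obtain ⟨hacT, hintT⟩ := klDiv_ne_top_iff.1 (h ▸ hfin)
  set F := μ.rnDeriv ν with hF
  set G := (μ.map T).rnDeriv (ν.map T) with hG
  have hFm : Measurable F := Measure.measurable_rnDeriv _ _
  have hllT : Integrable (fun x => llr (μ.map T) (ν.map T) (T x)) μ :=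
    (integrable_map_measure hintT.1 hT.aemeasurable).1 hintT
  have hzero : ∫ x, llr μ ν x ∂μ = ∫ x, llr (μ.map T) (ν.map T) (T x) ∂μ := by
    have h' := congrArg ENNReal.toReal h
    rw [toReal_klDiv_of_measure_eq hac (by simp), toReal_klDiv_of_measure_eq hacT (by simp),
      integral_map hT.aemeasurable hintT.1] at h'
    exact h'.symm
  have i1 : Integrable (fun x => (F x).toReal • llr μ ν x) ν :=
    (integrable_rnDeriv_smul_iff hac).2 hint
  have i2 : Integrable (fun x => (F x).toReal • llr (μ.map T) (ν.map T) (T x)) ν :=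
    (integrable_rnDeriv_smul_iff hac).2 hllT
  have i3 : Integrable (fun x => (F x).toReal) ν := Measure.integrable_toReal_rnDeriv
  have i4' : Integrable (fun x => (G x).toReal) (ν.map T) := Measure.integrable_toReal_rnDeriv
  have i4 : Integrable (fun x => (G (T x)).toReal) ν :=
    (integrable_map_measure i4'.1 hT.aemeasurable).1 i4'
  have hGpos : ∀ᵐ x ∂ν, F x ≠ 0 → 0 < G (T x) := by
    have h1 : ∀ᵐ x ∂μ, 0 < G (T x) :=
      ae_of_ae_map hT.aemeasurable (Measure.rnDeriv_pos hacT)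
    rw [← Measure.withDensity_rnDeriv_eq μ ν hac] at h1
    exact (ae_withDensity_iff hFm).1 h1
  have hFtop : ∀ᵐ x ∂ν, F x ≠ ∞ := Measure.rnDeriv_ne_top _ _
  have hGtop : ∀ᵐ x ∂ν, G (T x) ≠ ∞ :=
    ae_of_ae_map hT.aemeasurable (Measure.rnDeriv_ne_top (μ.map T) (ν.map T))
  -- The pointwise form of Gibbs' inequality, from `log t ≤ t - 1` at `t = g / f`. With `f = F` and
  -- `g = G ∘ T`, the integral of this nonnegative expression is the difference of the two
  -- divergences, hence zero, and so `F = G ∘ T` almost everywhere.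
  have key : ∀ f g : ℝ, 0 ≤ f → 0 ≤ g → (f ≠ 0 → 0 < g) →
      0 ≤ f * Real.log f - f * Real.log g - f + g ∧
      (f * Real.log f - f * Real.log g - f + g = 0 → f = g) := by
    intro f g hf hg hfg
    rcases hf.eq_or_lt with rfl | hf
    · simp only [zero_mul, sub_zero, zero_add]; exact ⟨hg, fun h => h.symm⟩
    have hg := hfg hf.ne'
    have hl : Real.log (g / f) = Real.log g - Real.log f := Real.log_div hg.ne' hf.ne'
    have e : f * Real.log f - f * Real.log g - f + g = f * (g / f - 1 - Real.log (g / f)) := by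
      rw [hl]; field_simp; ring
    rw [e]
    refine ⟨mul_nonneg hf.le (by linarith [Real.log_le_sub_one_of_pos (div_pos hg hf)]), ?_⟩
    intro h0
    by_contra hne
    have := Real.log_lt_sub_one_of_pos (div_pos hg hf)
      (fun h1 => hne ((div_eq_one_iff_eq hf.ne').1 h1).symm)
    have := mul_pos hf (sub_pos.2 this)
    linarith
  have i12 : Integrable (fun x => (F x).toReal • llr μ ν x -
      (F x).toReal • llr (μ.map T) (ν.map T) (T x)) ν := i1.sub i2
  have i123 : Integrable (fun x => (F x).toReal • llr μ ν x -
      (F x).toReal • llr (μ.map T) (ν.map T) (T x) - (F x).toReal) ν := i12.sub i3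
  have hB : ∫ x, ((F x).toReal • llr μ ν x - (F x).toReal • llr (μ.map T) (ν.map T) (T x)
      - (F x).toReal + (G (T x)).toReal) ∂ν = 0 := by
    rw [integral_add i123 i4, integral_sub i12 i3, integral_sub i1 i2,
      integral_rnDeriv_smul hac, integral_rnDeriv_smul hac, hzero,
      Measure.integral_toReal_rnDeriv hac,
      ← integral_map (f := fun y => (G y).toReal) hT.aemeasurable i4'.1,
      Measure.integral_toReal_rnDeriv hacT]
    simp
  erw [integral_eq_zero_iff_of_nonneg_ae ?_ (i123.add i4)] at hB
  · conv_lhs => rw [← Measure.withDensity_rnDeriv_eq μ ν hac]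
    refine withDensity_congr_ae ?_
    filter_upwards [hB, hGpos, hFtop, hGtop] with x hx h1 h2 h3
    have := (key (F x).toReal (G (T x)).toReal ENNReal.toReal_nonneg ENNReal.toReal_nonneg
      fun h => ENNReal.toReal_pos (h1 fun h' => h (by simp [h'])).ne' h3).2 hx
    exact (ENNReal.toReal_eq_toReal_iff' h2 h3).1 this
  · filter_upwards [hGpos, hFtop, hGtop] with x h1 h2 h3
    exact (key (F x).toReal (G (T x)).toReal ENNReal.toReal_nonneg ENNReal.toReal_nonneg
      fun h => ENNReal.toReal_pos (h1 fun h' => h (by simp [h'])).ne' h3).1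

/-- A logarithmically integrable bound on the density makes the divergence finite. -/
lemma klDiv_ne_top_of_le_withDensity {μ ν : Measure α} [IsProbabilityMeasure μ]
    [IsProbabilityMeasure ν] {g : α → ℝ} (hg : Measurable g)
    (hle : μ ≤ ν.withDensity fun x => ENNReal.ofReal (g x))
    (hlog : ∫⁻ x, ENNReal.ofReal (Real.log (g x)) ∂μ ≠ ∞) : klDiv μ ν ≠ ∞ := by
  have hac : μ ≪ ν :=
    (Measure.absolutelyContinuous_of_le hle).trans (withDensity_absolutelyContinuous _ _)
  have hFm : Measurable (μ.rnDeriv ν) := Measure.measurable_rnDeriv _ _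
  have hFg : μ.rnDeriv ν ≤ᵐ[ν] fun x => ENNReal.ofReal (g x) := by
    refine ae_le_of_forall_setLIntegral_le_of_sigmaFinite hFm fun s hs _ => ?_
    rw [← withDensity_apply _ hs, ← withDensity_apply _ hs, Measure.withDensity_rnDeriv_eq _ _ hac]
    exact hle s
  rw [klDiv_eq_lintegral_klFun_of_ac hac]
  have hbound : ∫⁻ x, ENNReal.ofReal (klFun (μ.rnDeriv ν x).toReal) ∂ν ≤
      ∫⁻ x, (μ.rnDeriv ν x * ENNReal.ofReal (Real.log (g x)) + 1) ∂ν := by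
    refine lintegral_mono_ae ?_
    filter_upwards [hFg, Measure.rnDeriv_ne_top μ ν] with x hx hx'
    set f := (μ.rnDeriv ν x).toReal with hf
    have hf0 : 0 ≤ f := ENNReal.toReal_nonneg
    have e : μ.rnDeriv ν x = ENNReal.ofReal f := (ENNReal.ofReal_toReal hx').symm
    rw [e] at hx ⊢
    rw [← ENNReal.ofReal_mul hf0, ← ENNReal.ofReal_one]
    rcases hf0.eq_or_lt with h0 | h0
    · rw [← h0]; simp [klFun_zero]
    have hfg : f ≤ g x := by
      rcases (ENNReal.ofReal_le_ofReal_iff' ).1 hx with h | h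
      · exact h
      · linarith
    -- Since `f ≤ g`, `f log f + 1 - f ≤ f log g + 1`.
    refine (ENNReal.ofReal_le_ofReal ?_).trans ENNReal.ofReal_add_le
    rw [klFun_apply]
    have := mul_le_mul_of_nonneg_left (Real.log_le_log h0 hfg) hf0
    linarith
  refine ne_top_of_le_ne_top ?_ hbound
  rw [lintegral_add_right _ measurable_const,
    lintegral_rnDeriv_mul hac (f := fun x => ENNReal.ofReal (Real.log (g x)))
      (Real.measurable_log.comp hg).ennreal_ofReal.aemeasurable]
  simp [hlog]

end KL

/-! ### Distributions of finite entropy -/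

section Entropy

variable {S : Type*} [MeasurableSpace S]

/-- The measure of the fibre of `h` through `s`. -/
noncomputable def fibreMass {W : Type*} (ν : Measure S) (h : S → W) (s : S) : ℝ≥0∞ :=
  ν {s' | h s' = h s}

lemma fibreMass_ne_zero_ae {W : Type*} [Countable W] (ν : Measure S) (h : S → W) :
    ∀ᵐ s ∂ν, fibreMass ν h s ≠ 0 := by
  rw [ae_iff]
  refine measure_mono_null (t := ⋃ w : {w : W // ν {s' | h s' = w} = 0}, {s' | h s' = w})
    (fun s hs => Set.mem_iUnion.2 ⟨⟨h s, not_not.1 hs⟩, rfl⟩) ?_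
  exact measure_iUnion_null fun w => w.2

lemma measurable_fibreMass {ν : Measure S} [IsFiniteMeasure ν] {h : S → ℕ → Bool}
    (hh : Measurable h) : Measurable (fibreMass ν h) :=
  measurable_measure_prodMk_left (ν := ν) (s := {p : S × S | h p.2 = h p.1})
    (measurableSet_eq_fun (hh.comp measurable_snd) (hh.comp measurable_fst))

/-- The left side is the entropy of the finite coarse-graining `g` in nats; the factor `log 2`
converts from bits. -/
lemma lintegral_log_fibreMass_le {ν : Measure S} [IsProbabilityMeasure ν] {W : Type*} [Fintype W]
    [MeasurableSpace W] [DiscreteMeasurableSpace W] {g : S → W} (hg : Measurable g) :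
    ∫⁻ s, ENNReal.ofReal (-Real.log (fibreMass ν g s).toReal) ∂ν ≤
      ENNReal.ofReal (Real.log 2) * shannonEntropy ν := by
  have hlog : 0 < Real.log 2 := Real.log_pos one_lt_two
  let e := Fintype.equivFin W
  have h1 : ∫⁻ s, ENNReal.ofReal (-Real.log (fibreMass ν g s).toReal) ∂ν =
      ∑ w, ENNReal.ofReal (-Real.log (ν.real (g ⁻¹' {w}))) * ν (g ⁻¹' {w}) := by
    have := lintegral_map (μ := ν)
      (f := fun w => ENNReal.ofReal (-Real.log (ν.real (g ⁻¹' {w})))) (measurable_of_countable _) hg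
    rw [lintegral_fintype] at this
    refine this.symm.trans (Finset.sum_congr rfl fun w _ => ?_)
    rw [Measure.map_apply hg (measurableSet_singleton w)]
  have h2 : ∀ w, ENNReal.ofReal (-Real.log (ν.real (g ⁻¹' {w}))) * ν (g ⁻¹' {w}) =
      ENNReal.ofReal (Real.log 2) *
        ENNReal.ofReal (Real.negMulLog (ν.real (g ⁻¹' {w})) / Real.log 2) := by
    intro w
    rw [← ENNReal.ofReal_mul hlog.le, mul_div_cancel₀ _ hlog.ne',
      ← ENNReal.ofReal_toReal (measure_ne_top ν (g ⁻¹' {w})),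
      ← ENNReal.ofReal_mul' ENNReal.toReal_nonneg, Real.negMulLog]
    congr 1
    simp only [Measure.real]
    ring
  rw [h1, Finset.sum_congr rfl fun w _ => h2 w, ← Finset.mul_sum]
  gcongr
  refine le_iSup₂_of_le (Fintype.card W) ⟨e ∘ g, (measurable_of_countable e).comp hg⟩ ?_
  refine le_trans ?_ (Equiv.sum_comp e (fun i => ENNReal.ofReal
    (Real.negMulLog (ν.real ((e ∘ g) ⁻¹' {i})) / Real.log 2))).le
  refine Finset.sum_le_sum fun w _ => le_of_eq ?_
  congr 4
  ext s
  simp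

/-- Any distribution has a finest countably generated discretisation, whose fibres are atoms. -/
lemma exists_atomic_coding (ν : Measure S) [IsProbabilityMeasure ν] :
    ∃ h : S → ℕ → Bool, Measurable h ∧ ∀ E, MeasurableSet E → ∀ c,
      ν (E ∩ h ⁻¹' {c}) = 0 ∨ ν (E ∩ h ⁻¹' {c}) = ν (h ⁻¹' {c}) := by
  -- `Q h` is the probability that `h` fails to separate two independent samples. Countably many
  -- codings can be merged into one, so the infimum of `Q` is attained.
  let Q : {h : S → ℕ → Bool // Measurable h} → ℝ≥0∞ := fun h => ∫⁻ s, fibreMass ν h.1 s ∂ν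
  have : Nonempty {h : S → ℕ → Bool // Measurable h} := ⟨⟨fun _ _ => false, measurable_const⟩⟩
  obtain ⟨u, -, hu, hmem⟩ := exists_seq_tendsto_sInf (Set.range_nonempty Q) (OrderBot.bddBelow _)
  choose hk hhk using hmem
  let h : S → ℕ → Bool := fun s n => (hk n.unpair.1).1 s n.unpair.2
  have hm : Measurable h := measurable_pi_lambda _ fun n =>
    (measurable_pi_apply n.unpair.2).comp (hk n.unpair.1).2
  have hmin : ∀ h', Q ⟨h, hm⟩ ≤ Q h' := by
    intro h'
    refine le_trans (ge_of_tendsto' hu fun k => ?_) (sInf_le ⟨h', rfl⟩)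
    rw [← hhk k]
    refine lintegral_mono fun s => measure_mono fun s' hs' => funext fun n => ?_
    simpa [h] using congrFun hs' (Nat.pair k n)
  refine ⟨h, hm, fun E hE c => ?_⟩
  classical
  -- Adding the bit `s ∈ E` cannot lower `Q` further, so almost every fibre keeps its mass: `E`
  -- cannot split a fibre into two parts of positive mass.
  let h' : S → ℕ → Bool := fun s n => Nat.casesOn n (decide (s ∈ E)) (fun n => h s n)
  have hm' : Measurable h' := measurable_pi_lambda _ fun n => by
    cases n with
    | zero => exact measurable_to_bool (by convert hE; ext; simp [h'])
    | succ n => exact (measurable_pi_apply n).comp hm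
  have hsub : ∀ s s', h' s' = h' s ↔ (s' ∈ E ↔ s ∈ E) ∧ h s' = h s := by
    intro s s'
    constructor
    · intro H
      exact ⟨by simpa [h'] using congrFun H 0, funext fun n => congrFun H (n + 1)⟩
    · rintro ⟨H1, H2⟩
      funext n
      cases n with
      | zero => simpa [h'] using H1
      | succ n => exact congrFun H2 n
  have hle : fibreMass ν h' ≤ fibreMass ν h := fun s =>
    measure_mono fun s' hs' => ((hsub s s').1 hs').2
  have hae : fibreMass ν h' =ᵐ[ν] fibreMass ν h := by
    refine ae_eq_of_ae_le_of_lintegral_le (Eventually.of_forall hle) ?_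
      (measurable_fibreMass hm).aemeasurable (hmin ⟨h', hm'⟩)
    refine ne_top_of_le_ne_top ENNReal.one_ne_top ?_
    calc ∫⁻ s, fibreMass ν h' s ∂ν ≤ ∫⁻ _, 1 ∂ν := lintegral_mono fun s => prob_le_one
      _ = 1 := by simp
  rw [or_iff_not_imp_left]
  intro hne
  obtain ⟨s, ⟨hsE, hsc⟩, hs⟩ : ∃ s ∈ E ∩ h ⁻¹' {c}, fibreMass ν h' s = fibreMass ν h s := by
    by_contra! hcon
    exact hne (measure_mono_null (fun s hs => hcon s hs) (ae_iff.1 hae))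
  have hsc : h s = c := hsc
  simp only [fibreMass, hsub, hsE, iff_true, hsc] at hs
  exact hs

/-- The fibres of the first `k` bits decrease to those of `h`, and Fatou's lemma carries the entropy
bound to the limit. On a null fibre the logarithms would diverge, against this bound. The first
claim is needed separately because `Real.log 0 = 0` hides null fibres from the integral. -/
lemma lintegral_log_fibreMass_cantor {ν : Measure S} [IsProbabilityMeasure ν]
    (hν : shannonEntropy ν ≠ ∞) {h : S → ℕ → Bool} (hh : Measurable h) :
    (∀ᵐ s ∂ν, fibreMass ν h s ≠ 0) ∧
      ∫⁻ s, ENNReal.ofReal (-Real.log (fibreMass ν h s).toReal) ∂ν ≠ ∞ := by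
  let g : (k : ℕ) → S → Fin k → Bool := fun k s i => h s i
  have hg : ∀ k, Measurable (g k) := fun k => measurable_pi_lambda _ fun i =>
    (measurable_pi_apply (i : ℕ)).comp hh
  have hlim : ∀ s, Tendsto (fun k => fibreMass ν (g k) s) atTop (nhds (fibreMass ν h s)) := by
    intro s
    have hset : {s' | h s' = h s} = ⋂ k, {s' | g k s' = g k s} := by
      ext s'
      rw [Set.mem_iInter]
      refine ⟨fun H k => funext fun i => congrFun H i, fun H => funext fun n => ?_⟩
      exact congrFun (H (n + 1)) ⟨n, n.lt_succ_self⟩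
    rw [fibreMass, hset]
    refine tendsto_measure_iInter_atTop (fun k => ?_) (fun k l hkl s' hs' => funext fun i => ?_)
      ⟨0, measure_ne_top _ _⟩
    · exact (hg k (measurableSet_singleton (g k s))).nullMeasurableSet
    · exact congrFun hs' ⟨i, i.2.trans_le hkl⟩
  have hpos : ∀ᵐ s ∂ν, ∀ k, fibreMass ν (g k) s ≠ 0 :=
    ae_all_iff.2 fun k => fibreMass_ne_zero_ae ν (g k)
  let ψ : S → ℝ≥0∞ := fun s => liminf (fun k =>
    ENNReal.ofReal (-Real.log (fibreMass ν (g k) s).toReal)) atTop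
  have hmeas : ∀ k, Measurable fun s =>
      ENNReal.ofReal (-Real.log (fibreMass ν (g k) s).toReal) := fun k =>
    (measurable_of_countable fun w : Fin k → Bool =>
      ENNReal.ofReal (-Real.log (ν {s' | g k s' = w}).toReal)).comp (hg k)
  have hψ : ∫⁻ s, ψ s ∂ν ≠ ∞ := by
    refine ne_top_of_le_ne_top (ENNReal.mul_ne_top (ENNReal.ofReal_ne_top (r := Real.log 2)) hν)
      ((lintegral_liminf_le hmeas).trans ?_)
    refine (liminf_le_liminf (Eventually.of_forall fun k =>
      lintegral_log_fibreMass_le (ν := ν) (hg k))).trans (by simp)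
  have hlimR : ∀ s, Tendsto (fun k => (fibreMass ν (g k) s).toReal) atTop
      (nhds (fibreMass ν h s).toReal) := fun s =>
    (ENNReal.tendsto_toReal (measure_ne_top _ _)).comp (hlim s)
  have hne : ∀ᵐ s ∂ν, fibreMass ν h s ≠ 0 := by
    filter_upwards [hpos, ae_lt_top (Measurable.liminf hmeas) hψ] with s hs hs' h0
    refine hs'.ne (Tendsto.liminf_eq ?_)
    refine ENNReal.tendsto_ofReal_atTop.comp (tendsto_neg_atBot_atTop.comp
      (Real.tendsto_log_nhdsGT_zero.comp (tendsto_nhdsWithin_iff.2 ⟨?_, ?_⟩)))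
    · simpa [h0] using hlimR s
    · exact Eventually.of_forall fun k => ENNReal.toReal_pos (hs k) (measure_ne_top _ _)
  refine ⟨hne, ?_⟩
  rwa [lintegral_congr_ae (g := ψ)]
  filter_upwards [hne] with s hs
  refine (Tendsto.liminf_eq ?_).symm
  exact (ENNReal.continuous_ofReal.tendsto _).comp
    (((Real.continuousAt_log (ENNReal.toReal_pos hs (measure_ne_top _ _)).ne').tendsto.comp
      (hlimR s)).neg)

/-- Conditionally on an atom, every event of the first coordinate has probability `0` or `1`, so it
is independent of the second coordinate. -/
lemma restrict_eq_prod_of_atom {V : Type*} [MeasurableSpace V] {μ : Measure (S × V)}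
    [IsProbabilityMeasure μ] {C : Set S} (hC : MeasurableSet C)
    (hpos : μ.map Prod.fst C ≠ 0)
    (hatom : ∀ E, MeasurableSet E → μ.map Prod.fst (E ∩ C) = 0 ∨
      μ.map Prod.fst (E ∩ C) = μ.map Prod.fst C) :
    μ.restrict (Prod.fst ⁻¹' C) = ((μ.map Prod.fst C)⁻¹ • (μ.map Prod.fst).restrict C).prod
      ((μ.restrict (Prod.fst ⁻¹' C)).map Prod.snd) := by
  have := Measure.isProbabilityMeasure_map (μ := μ) measurable_fst.aemeasurable
  have hfin : IsFiniteMeasure ((μ.map Prod.fst C)⁻¹ • (μ.map Prod.fst).restrict C) :=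
    ⟨by simp [lt_top_iff_ne_top, ENNReal.mul_ne_top (ENNReal.inv_ne_top.2 hpos)]⟩
  refine (Measure.prod_eq fun s t hs ht => ?_).symm
  rw [Measure.restrict_apply (hs.prod ht), Measure.map_apply measurable_snd ht,
    Measure.restrict_apply (measurable_snd ht), Measure.smul_apply, Measure.restrict_apply hs,
    smul_eq_mul]
  have hCm : MeasurableSet (Prod.fst ⁻¹' C : Set (S × V)) := measurable_fst hC
  have hsC : MeasurableSet (Prod.fst ⁻¹' (s ∩ C) : Set (S × V)) := measurable_fst (hs.inter hC)
  have he : s ×ˢ t ∩ Prod.fst ⁻¹' C = Prod.snd ⁻¹' t ∩ Prod.fst ⁻¹' (s ∩ C) := by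
    ext ⟨a, b⟩; simp only [Set.mem_inter_iff, Set.mem_prod, Set.mem_preimage]; tauto
  rw [he]
  rcases hatom s hs with h0 | h1
  · rw [h0, mul_zero, zero_mul]
    rw [Measure.map_apply measurable_fst (hs.inter hC)] at h0
    exact measure_mono_null Set.inter_subset_right h0
  · rw [h1, ENNReal.inv_mul_cancel hpos (measure_ne_top _ _), one_mul]
    rw [Measure.map_apply measurable_fst (hs.inter hC), Measure.map_apply measurable_fst hC] at h1
    have hae : (Prod.fst ⁻¹' (s ∩ C) : Set (S × V)) =ᵐ[μ] Prod.fst ⁻¹' C :=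
      ae_eq_of_subset_of_measure_ge (fun x hx => hx.2) h1.ge hsC.nullMeasurableSet
        (measure_ne_top _ _)
    exact measure_congr ((ae_eq_refl _).inter hae)

/-- A variable of finite entropy has finite mutual information with any other variable. -/
lemma klDiv_prod_ne_top {V : Type*} [MeasurableSpace V] (μ : Measure (S × V))
    [IsProbabilityMeasure μ] (hμ : shannonEntropy (μ.map Prod.fst) ≠ ∞) :
    klDiv μ ((μ.map Prod.fst).prod (μ.map Prod.snd)) ≠ ∞ := by
  have := Measure.isProbabilityMeasure_map (μ := μ) measurable_fst.aemeasurable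
  have := Measure.isProbabilityMeasure_map (μ := μ) measurable_snd.aemeasurable
  set ν := μ.map Prod.fst with hν
  obtain ⟨h, hh, hatom⟩ := exists_atomic_coding ν
  obtain ⟨hne, hint⟩ := lintegral_log_fibreMass_cantor hμ hh
  have hφ : Measurable fun s => ((fibreMass ν h s).toReal)⁻¹ :=
    (measurable_fibreMass hh).ennreal_toReal.inv
  refine klDiv_ne_top_of_le_withDensity (g := fun x => ((fibreMass ν h x.1).toReal)⁻¹)
    (hφ.comp measurable_fst) ?_ ?_
  -- Almost every point lies in one of countably many atoms. On an atom `C`, `μ` is a product whose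
  -- second factor is at most the full second marginal, so the density is at most `1 / ν C`.
  · let N : Set (ℕ → Bool) := {c | 0 < ν (h ⁻¹' {c})}
    have hN : N.Countable := by
      refine Measure.countable_meas_pos_of_disjoint_iUnion (μ := ν) (As := fun c => h ⁻¹' {c})
        (fun c => hh (measurableSet_singleton c)) fun c c' hcc => ?_
      exact Set.disjoint_left.2 fun s hs hs' => hcc ((Set.mem_singleton_iff.1 hs).symm.trans hs')
    have : Countable N := hN
    refine Measure.le_iff.2 fun M hM => ?_
    let D : N → Set (S × V) := fun c => Prod.fst ⁻¹' (h ⁻¹' {c.1})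
    have hD : ∀ c, MeasurableSet (D c) := fun c =>
      measurable_fst (hh (measurableSet_singleton c.1))
    have hDisj : Pairwise (Function.onFun Disjoint fun c => M ∩ D c) := fun c c' hcc =>
      Set.disjoint_left.2 fun s hs hs' =>
        hcc (Subtype.ext ((Set.mem_singleton_iff.1 hs.2).symm.trans hs'.2))
    have hcover : μ M ≤ ∑' c, μ (M ∩ D c) := by
      rw [← measure_iUnion hDisj fun c => hM.inter (hD c)]
      refine measure_mono_ae ?_
      filter_upwards [ae_of_ae_map measurable_fst.aemeasurable hne] with x hx hxM
      exact Set.mem_iUnion.2 ⟨⟨h x.1, pos_iff_ne_zero.2 hx⟩, hxM, rfl⟩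
    refine hcover.trans ?_
    rw [withDensity_apply _ hM]
    refine le_trans ?_ (lintegral_mono_set (s := ⋃ c, M ∩ D c)
      (Set.iUnion_subset fun c => Set.inter_subset_left))
    rw [lintegral_iUnion (fun c => hM.inter (hD c)) hDisj]
    refine ENNReal.tsum_le_tsum fun c => ?_
    have hp : ν (h ⁻¹' {c.1}) ≠ 0 := c.2.ne'
    have hconst : ∫⁻ x in M ∩ D c, ENNReal.ofReal ((fibreMass ν h x.1).toReal)⁻¹
        ∂ν.prod (μ.map Prod.snd) =
        (ν (h ⁻¹' {c.1}))⁻¹ * (ν.prod (μ.map Prod.snd)) (M ∩ D c) := by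
      rw [← setLIntegral_const]
      refine setLIntegral_congr_fun (hM.inter (hD c)) fun x hx => ?_
      have hx2 : h x.1 = c.1 := hx.2
      have : fibreMass ν h x.1 = ν (h ⁻¹' {c.1}) := by rw [fibreMass, hx2]; rfl
      simp only [this]
      rw [ENNReal.ofReal_inv_of_pos (ENNReal.toReal_pos hp (measure_ne_top _ _)),
        ENNReal.ofReal_toReal (measure_ne_top _ _)]
    rw [hconst, ← Measure.restrict_apply hM,
      restrict_eq_prod_of_atom (hh (measurableSet_singleton c.1)) hp
        (fun E hE => hatom E hE c.1)]
    have hle : (μ.restrict (D c)).map Prod.snd ≤ μ.map Prod.snd :=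
      Measure.map_mono Measure.restrict_le_self measurable_snd
    have hD' : D c = (h ⁻¹' {c.1}) ×ˢ Set.univ := by ext; simp [D]
    rw [Measure.prod_apply hM, lintegral_smul_measure, smul_eq_mul, ← Measure.restrict_apply hM,
      hD', ← Measure.prod_restrict, Measure.restrict_univ, Measure.prod_apply hM]
    gcongr
  · have := lintegral_map (μ := μ) (f := fun s =>
      ENNReal.ofReal (-Real.log (fibreMass ν h s).toReal))
      (((Real.measurable_log.comp (measurable_fibreMass hh).ennreal_toReal).neg).ennreal_ofReal)
      measurable_fst
    simp only [Real.log_inv]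
    rw [← this]
    exact hint

end Entropy

/-! ### Cylinder sets of one-sided sequences -/

section Sequences

variable {A B : Type*}

@[simp] lemma glue_past_future (x : ℤ → A) : glue (past x) (future x) = x := by
  funext t
  cases t <;> rfl

lemma glue_congr {p f f' : ℕ → A} {L : ℕ} (h : ∀ k < L, f k = f' k) (s : ℤ) (hs : s < L) :
    glue p f s = glue p f' s := by
  cases s with
  | ofNat k => exact h k (by simpa using hs)
  | negSucc k => rfl

/-- The sequences whose first `L` symbols agree with `w`. -/
def cyl (w : ℕ → B) (L : ℕ) : Set (ℕ → B) := {y | ∀ k < L, y k = w k}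

/-- A word, extended to a sequence by an arbitrary symbol. -/
noncomputable def pad [Nonempty A] {L : ℕ} (a : Fin L → A) : ℕ → A :=
  fun k => if h : k < L then a ⟨k, h⟩ else Classical.arbitrary A

lemma pad_apply [Nonempty A] (w : ℕ → A) {L k : ℕ} (h : k < L) :
    pad (fun i : Fin L => w i) k = w k := by simp [pad, h]

lemma cylinder_eq (p : ℕ → B) (n : ℕ) (w : ℕ → B) (L : ℕ) :
    cylinder p n w L = past ⁻¹' cyl p n ∩ future ⁻¹' cyl w L := rfl

lemma cyl_zero (w : ℕ → B) : cyl w 0 = Set.univ := by ext; simp [cyl]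

lemma cylinder_zero (p : ℕ → B) (n : ℕ) (w : ℕ → B) : cylinder p n w 0 = past ⁻¹' cyl p n := by
  simp [cylinder_eq, cyl_zero]

lemma cyl_congr {w w' : ℕ → B} {L : ℕ} (h : ∀ k < L, w k = w' k) : cyl w L = cyl w' L := by
  ext y
  exact forall₂_congr fun k hk => by rw [h k hk]

variable [MeasurableSpace A] [MeasurableSpace B]

@[fun_prop] lemma measurable_past : Measurable (past : (ℤ → A) → ℕ → A) :=
  measurable_pi_lambda _ fun k => measurable_pi_apply (Int.negSucc k)

@[fun_prop] lemma measurable_future : Measurable (future : (ℤ → A) → ℕ → A) :=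
  measurable_pi_lambda _ fun k => measurable_pi_apply (Int.ofNat k)

@[fun_prop] lemma measurable_jointPast :
    Measurable (jointPast : (ℤ → A) × (ℤ → B) → JointPast A B) :=
  (measurable_past.comp measurable_fst).prodMk (measurable_past.comp measurable_snd)

lemma measurable_glue : Measurable fun q : (ℕ → A) × (ℕ → A) => glue q.1 q.2 := by
  refine measurable_pi_lambda _ fun t => ?_
  cases t with
  | ofNat k => exact (measurable_pi_apply k).comp measurable_snd
  | negSucc k => exact (measurable_pi_apply k).comp measurable_fst

variable [Countable B] [DiscreteMeasurableSpace B]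

lemma measurableSet_cyl (w : ℕ → B) (L : ℕ) : MeasurableSet (cyl w L) := by
  have : cyl w L = ⋂ k : Fin L, (fun y : ℕ → B => y k) ⁻¹' {w k} := by
    ext y
    simp only [Set.mem_iInter]
    exact ⟨fun h k => h k k.2, fun h k hk => h ⟨k, hk⟩⟩
  rw [this]
  exact MeasurableSet.iInter fun k => measurable_pi_apply _ (measurableSet_singleton _)

lemma generateFrom_cyl [Nonempty B] :
    (MeasurableSpace.pi : MeasurableSpace (ℕ → B)) =
      MeasurableSpace.generateFrom {s | ∃ w L, s = cyl w L} := by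
  refine le_antisymm (iSup_le fun k => ?_) (MeasurableSpace.generateFrom_le ?_)
  · rw [← measurable_iff_comap_le]
    refine @measurable_to_countable' B (ℕ → B) _ _
      (MeasurableSpace.generateFrom {s | ∃ w L, s = cyl w L}) _ fun b => ?_
    have : (fun y : ℕ → B => y k) ⁻¹' {b} =
        ⋃ v : {v : Fin (k + 1) → B // v (Fin.last k) = b}, cyl (pad v.1) (k + 1) := by
      ext y
      simp only [Set.mem_preimage, Set.mem_singleton_iff, Set.mem_iUnion]
      constructor
      · exact fun h => ⟨⟨fun i => y i, h⟩, fun i hi => (pad_apply y hi).symm⟩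
      · rintro ⟨⟨v, hv⟩, h⟩
        rw [h k k.lt_succ_self]
        simpa [pad, Fin.last] using hv
    rw [this]
    exact MeasurableSet.iUnion fun v => MeasurableSpace.measurableSet_generateFrom ⟨_, _, rfl⟩
  · rintro s ⟨w, L, rfl⟩
    exact measurableSet_cyl w L

/-- Finite measures on one-sided sequences are determined by the cylinders. -/
lemma ext_of_cyl [Nonempty B] {μ ν : Measure (ℕ → B)} [IsFiniteMeasure μ]
    (h : ∀ w L, μ (cyl w L) = ν (cyl w L)) : μ = ν := by
  refine ext_of_generate_finite _ generateFrom_cyl ?_ ?_ ?_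
  · rintro _ ⟨w, L, rfl⟩ _ ⟨w', L', rfl⟩ ⟨y, hy, hy'⟩
    refine ⟨y, max L L', ?_⟩
    ext z
    constructor
    · rintro ⟨hz, hz'⟩ k hk
      rcases lt_max_iff.1 hk with hk | hk
      · rw [hz k hk, hy k hk]
      · rw [hz' k hk, hy' k hk]
    · intro hz
      exact ⟨fun k hk => (hz k (lt_max_of_lt_left hk)).trans (hy k hk),
        fun k hk => (hz k (lt_max_of_lt_right hk)).trans (hy' k hk)⟩
  · rintro _ ⟨w, L, rfl⟩
    exact h w L
  · simpa [cyl_zero] using h (Classical.arbitrary _) 0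

end Sequences

/-! ### Word probabilities of a causal channel -/

section Channel

variable {A B : Type*} [MeasurableSpace A] [MeasurableSpace B]
  [Countable B] [DiscreteMeasurableSpace B]

section Causal

variable {κ : Kernel (ℤ → A) (ℤ → B)}

/-- The cylinder prescribes a single word on the window from `-n` to `L - 1`. Pasts are read
backwards, so position `i < n` of that word is past index `n - 1 - i`. -/
lemma IsCausalChannel.apply_cylinder (hκ : IsCausalChannel κ) {x x' : ℤ → A} {L : ℕ}
    (hx : ∀ s < (L : ℤ), x s = x' s)
    (p : ℕ → B) (n : ℕ) (w : ℕ → B) : κ x (cylinder p n w L) = κ x' (cylinder p n w L) := by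
  have h := hκ (-n) (n + L) x x' fun s hs => hx s (by push_cast at hs; linarith)
  have hmeas : Measurable fun (y : ℤ → B) (i : Fin (n + L)) => y (-n + (i : ℕ)) :=
    measurable_pi_lambda _ fun i => measurable_pi_apply _
  have hset : cylinder p n w L = (fun (y : ℤ → B) (i : Fin (n + L)) => y (-n + (i : ℕ))) ⁻¹'
      {fun i : Fin (n + L) => glue p w (-n + (i : ℕ))} := by
    ext y
    simp only [Set.mem_preimage, Set.mem_singleton_iff, funext_iff]
    constructor
    · rintro ⟨h1, h2⟩ ⟨i, hi⟩
      rcases lt_or_ge i n with hin | hin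
      · have e : (-n + (i : ℕ) : ℤ) = Int.negSucc (n - 1 - i) := by omega
        simp only [e]
        exact h1 (n - 1 - i) (by omega)
      · have e : (-n + (i : ℕ) : ℤ) = Int.ofNat (i - n) := by
          simp only [Int.ofNat_eq_natCast]; omega
        simp only [e]
        exact h2 (i - n) (by omega)
    · intro H
      refine ⟨fun k hk => ?_, fun k hk => ?_⟩
      · have e : (-n + ((n - 1 - k : ℕ) : ℤ)) = Int.negSucc k := by omega
        have := H ⟨n - 1 - k, by omega⟩
        simp only [e] at this
        exact this
      · have e : (-n + ((n + k : ℕ) : ℤ)) = Int.ofNat k := by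
          simp only [Int.ofNat_eq_natCast]; omega
        have := H ⟨n + k, by omega⟩
        simp only [e] at this
        exact this
  rw [hset, ← Measure.map_apply hmeas (measurableSet_singleton _), h,
    Measure.map_apply hmeas (measurableSet_singleton _)]

lemma IsCausalChannel.futureMorph_congr (hκ : IsCausalChannel κ) {z : JointPast A B}
    {u u' : ℕ → A} {w w' : ℕ → B} {L : ℕ}
    (hu : ∀ k < L, u k = u' k) (hw : ∀ k < L, w k = w' k) :
    futureMorph κ z u w L = futureMorph κ z u' w' L := by
  unfold futureMorph
  congr 1
  funext n
  -- The denominator concerns outputs before time `0` only, so it sees nothing of the future input.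
  rw [hκ.apply_cylinder (L := 0) (x' := glue z.1 u')
      (glue_congr (L := 0) fun k hk => absurd hk (by simp)),
    hκ.apply_cylinder (glue_congr hu), cylinder_eq, cylinder_eq z.2 n w', cyl_congr hw,
    cylinder_zero, cylinder_zero]

lemma IsCausalChannel.map_past [Nonempty B] [IsMarkovKernel κ] (hκ : IsCausalChannel κ)
    {x x' : ℤ → A} (h : past x = past x') : (κ x).map past = (κ x').map past := by
  refine ext_of_cyl fun w L => ?_
  rw [Measure.map_apply measurable_past (measurableSet_cyl w L),
    Measure.map_apply measurable_past (measurableSet_cyl w L), ← cylinder_zero w L w]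
  refine hκ.apply_cylinder (fun s hs => ?_) _ _ _
  cases s with
  | ofNat k => simp at hs; omega
  | negSucc k => exact congrFun h k

end Causal

/-! ### The futures morph as a conditional probability -/

section Conditional

variable (κ : Kernel (ℤ → A) (ℤ → B)) [IsMarkovKernel κ]

lemma measurable_futureMorph (w : ℕ → B) (L : ℕ) :
    Measurable fun q : (ℕ → A) × JointPast A B => futureMorph κ q.2 q.1 w L := by
  have key : ∀ n L, Measurable fun q : (ℕ → A) × JointPast A B =>
      κ (glue q.2.1 q.1) (cylinder q.2.2 n w L) := by
    intro n L
    have hg : Measurable fun q : (ℕ → A) × JointPast A B => glue q.2.1 q.1 :=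
      measurable_glue.comp ((measurable_fst.comp measurable_snd).prodMk measurable_fst)
    have hset : MeasurableSet {q : ((ℕ → A) × JointPast A B) × (ℤ → B) |
        q.2 ∈ cylinder q.1.2.2 n w L} := by
      refine MeasurableSet.inter
        (s₁ := {q : ((ℕ → A) × JointPast A B) × (ℤ → B) | ∀ k < n, past q.2 k = q.1.2.2 k})
        (s₂ := {q : ((ℕ → A) × JointPast A B) × (ℤ → B) | ∀ k < L, future q.2 k = w k}) ?_ ?_
      · simp only [Set.ofPred_forall]
        refine MeasurableSet.iInter fun k => MeasurableSet.iInter fun _ => ?_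
        exact measurableSet_eq_fun ((measurable_pi_apply k).comp
          (measurable_past.comp measurable_snd)) ((measurable_pi_apply k).comp
            (measurable_snd.comp (measurable_snd.comp measurable_fst)))
      · exact (measurable_future.comp measurable_snd) (measurableSet_cyl w L)
    exact Kernel.measurable_kernel_prodMk_left (κ := κ.comap _ hg) hset
  exact Measurable.limsup fun n => (key n L).div (key n 0)

variable [Nonempty B]

/-- For a fixed input, the futures morph is a conditional probability given the output past. -/
lemma setLIntegral_futureMorph_output (x : ℤ → A) (w : ℕ → B) (L : ℕ) {D : Set (ℕ → B)}
    (hD : MeasurableSet D) :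
    ∫⁻ y in past ⁻¹' D, futureMorph κ (past x, past y) (future x) w L ∂(κ x) =
      κ x (past ⁻¹' D ∩ future ⁻¹' cyl w L) := by
  set m := κ x with hm
  set E : Set (ℤ → B) := future ⁻¹' cyl w L with hE
  have hEm : MeasurableSet E := measurable_future (measurableSet_cyl w L)
  let X : (n : ℕ) → (ℤ → B) → Fin n → B := fun n y k => past y k
  have hX : ∀ n, Measurable (X n) := fun n => measurable_pi_lambda _ fun k =>
    (measurable_pi_apply (k : ℕ)).comp measurable_past
  let ℱ : Filtration ℕ (inferInstance : MeasurableSpace (ℤ → B)) :=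
    { seq := fun n => MeasurableSpace.comap (X n) inferInstance
      mono' := fun n k hnk => by
        have : X n = (fun v (i : Fin n) => v (Fin.castLE hnk i)) ∘ X k := rfl
        change MeasurableSpace.comap (X n) _ ≤ _
        rw [this, ← MeasurableSpace.comap_comp]
        exact MeasurableSpace.comap_mono (measurable_of_countable _).comap_le
      le' := fun n => (hX n).comap_le }
  have hpastm : Measurable[⨆ n, ℱ n] (past : (ℤ → B) → ℕ → B) := by
    refine @measurable_pi_lambda _ _ _ (⨆ n, ℱ n) _ _ fun k => ?_
    have h1 : Measurable[ℱ (k + 1)] fun y : ℤ → B => past y k :=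
      (measurable_pi_apply (Fin.last k)).comp (comap_measurable (X (k + 1)))
    exact h1.mono (le_iSup (fun n => (ℱ n : MeasurableSpace (ℤ → B))) (k + 1)) le_rfl
  -- Almost every `y` lies in a cylinder of positive mass, so the convention `0/0 = 0` plays no role
  -- here.
  have hratio : ∀ n, ∀ᵐ y ∂m, m (cylinder (past y) n w L) / m (cylinder (past y) n w 0) =
      ENNReal.ofReal ((m⟦E | ℱ n⟧) y) := by
    intro n
    filter_upwards [condDistrib_ae_eq_condExp (μ := m) (hX n) measurable_id hEm,
      fibreMass_ne_zero_ae m (X n)] with y hy hy0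
    have hfib : cylinder (past y) n w 0 = X n ⁻¹' {X n y} := by
      ext y'
      rw [cylinder_zero]
      simp only [Set.mem_preimage, Set.mem_singleton_iff, funext_iff, X]
      exact ⟨fun h k => h k k.2, fun h k hk => h ⟨k, hk⟩⟩
    have hfib' : cylinder (past y) n w L = X n ⁻¹' {X n y} ∩ E := by
      rw [← hfib, cylinder_zero, cylinder_eq]
    have e : (m⟦E | ℱ n⟧) y = (condDistrib id (X n) m (X n y)).real E := hy.symm
    rw [e, ofReal_measureReal, condDistrib_apply_of_ne_zero measurable_id,
      Measure.map_apply (hX n) (measurableSet_singleton _),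
      Measure.map_apply ((hX n).prodMk measurable_id) ((measurableSet_singleton _).prod hEm),
      hfib, hfib', ENNReal.div_eq_inv_mul]
    · rfl
    · rwa [Measure.map_apply (hX n) (measurableSet_singleton _)]
  -- Lévy's upward theorem: almost surely the upper limit is a limit, the conditional probability
  -- given the whole output past.
  have hlim : ∀ᵐ y ∂m, futureMorph κ (past x, past y) (future x) w L =
      ENNReal.ofReal ((m⟦E | ⨆ n, ℱ n⟧) y) := by
    filter_upwards [ae_all_iff.2 hratio, tendsto_ae_condExp (μ := m) (ℱ := ℱ)
      (E.indicator fun _ => (1 : ℝ))] with y h1 h2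
    refine Tendsto.limsup_eq ?_
    simp only [glue_past_future, ← hm, h1]
    exact (ENNReal.continuous_ofReal.tendsto _).comp h2
  have hle : (⨆ n, ℱ n : MeasurableSpace (ℤ → B)) ≤ MeasurableSpace.pi :=
    iSup_le fun n => ℱ.le n
  rw [lintegral_congr_ae (ae_restrict_of_ae hlim), ← ofReal_integral_eq_lintegral_ofReal
    integrable_condExp.integrableOn, setIntegral_condExp hle
      ((integrable_const _).indicator hEm) (hpastm hD), setIntegral_indicator hEm]
  · simp
  · refine ae_restrict_of_ae (condExp_nonneg ?_)
    exact Eventually.of_forall fun y => Set.indicator_nonneg (fun _ _ => zero_le_one) y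

/-- The futures morph is the conditional probability of the output words given the future input
and the joint past. -/
lemma setLIntegral_futureMorph (X : ProbabilityMeasure (ℤ → A)) (w : ℕ → B) (L : ℕ)
    {C : Set ((ℕ → A) × JointPast A B)} (hC : MeasurableSet C) :
    ∫⁻ q in C, futureMorph κ q.2 q.1 w L
        ∂((jointProcess κ X).map fun ω => (future ω.1, jointPast ω)) =
      jointProcess κ X {ω | (future ω.1, jointPast ω) ∈ C ∧ future ω.2 ∈ cyl w L} := by
  have hT : Measurable fun ω : (ℤ → A) × (ℤ → B) => (future ω.1, jointPast ω) :=
    (measurable_future.comp measurable_fst).prodMk measurable_jointPast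
  have hf := measurable_futureMorph κ w L
  have hE : MeasurableSet {ω : (ℤ → A) × (ℤ → B) |
      (future ω.1, jointPast ω) ∈ C ∧ future ω.2 ∈ cyl w L} :=
    (hT hC).inter ((measurable_future.comp measurable_snd) (measurableSet_cyl w L))
  have hfT : Measurable fun ω : (ℤ → A) × (ℤ → B) =>
    futureMorph κ (future ω.1, jointPast ω).2 (future ω.1, jointPast ω).1 w L := hf.comp hT
  rw [setLIntegral_map hC hf hT, ← lintegral_indicator (hT hC), jointProcess,
    Measure.lintegral_compProd (hfT.indicator (hT hC)), Measure.compProd_apply hE]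
  refine lintegral_congr fun x => ?_
  have hD : MeasurableSet {q : ℕ → B | (future x, (past x, q)) ∈ C} :=
    (measurable_const.prodMk (measurable_const.prodMk measurable_id)) hC
  have h1 := setLIntegral_futureMorph_output κ x w L hD
  rw [← lintegral_indicator (measurable_past hD)] at h1
  refine Eq.trans (lintegral_congr fun y => ?_) (h1.trans (congrArg _ ?_))
  · by_cases hy : (future x, (past x, past y)) ∈ C
    · rw [Set.indicator_of_mem (show (x, y) ∈ _ from hy), Set.indicator_of_mem (show y ∈ _ from hy)]
      simp only [jointPast]
    · rw [Set.indicator_of_notMem (show (x, y) ∉ _ from hy),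
        Set.indicator_of_notMem (show y ∉ _ from hy)]
  · ext y
    rfl

end Conditional

end Channel

/-! ### Prescience and the futures morph -/

section Prescience

variable {A B : Type*} [MeasurableSpace A] [MeasurableSpace B]

/-- The joint law of the future input and the joint past. -/
noncomputable def pastLaw (κ : Kernel (ℤ → A) (ℤ → B)) (X : ProbabilityMeasure (ℤ → A)) :
    Measure ((ℕ → A) × JointPast A B) :=
  (jointProcess κ X).map fun ω => (future ω.1, jointPast ω)

/-- The joint law of the future input, the joint past and the future output. -/
noncomputable def tripleLaw (κ : Kernel (ℤ → A) (ℤ → B)) (X : ProbabilityMeasure (ℤ → A)) :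
    Measure ((ℕ → A) × (JointPast A B × (ℕ → B))) :=
  (jointProcess κ X).map fun ω => (future ω.1, (jointPast ω, future ω.2))

/-- The map that replaces the joint past by its state. -/
def mapState {S : Type*} (η : JointPast A B → S) :
    (ℕ → A) × (JointPast A B × (ℕ → B)) → (ℕ → A) × (S × (ℕ → B)) :=
  Prod.map id (Prod.map η id)

lemma measurable_mapState {S : Type*} [MeasurableSpace S] {η : JointPast A B → S}
    (hη : Measurable η) : Measurable (mapState η) :=
  measurable_id.prodMap (hη.prodMap measurable_id)

/-- The event that a state, with the future input, lies in `C` and the future output starts with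
the first `L` symbols of `w`. -/
def wordEvent {S : Type*} (C : Set ((ℕ → A) × S)) (w : ℕ → B) (L : ℕ) :
    Set ((ℕ → A) × (S × (ℕ → B))) :=
  {q | (q.1, q.2.1) ∈ C ∧ q.2.2 ∈ cyl w L}

lemma measurable_triple : Measurable fun ω : (ℤ → A) × (ℤ → B) =>
    (future ω.1, (jointPast ω, future ω.2)) :=
  (measurable_future.comp measurable_fst).prodMk
    (measurable_jointPast.prodMk (measurable_future.comp measurable_snd))

lemma measurable_pastPair : Measurable fun ω : (ℤ → A) × (ℤ → B) =>
    (future ω.1, jointPast ω) :=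
  (measurable_future.comp measurable_fst).prodMk measurable_jointPast

instance (κ : Kernel (ℤ → A) (ℤ → B)) [IsMarkovKernel κ] (X : ProbabilityMeasure (ℤ → A)) :
    IsProbabilityMeasure (pastLaw κ X) :=
  Measure.isProbabilityMeasure_map measurable_pastPair.aemeasurable

instance (κ : Kernel (ℤ → A) (ℤ → B)) [IsMarkovKernel κ] (X : ProbabilityMeasure (ℤ → A)) :
    IsProbabilityMeasure (tripleLaw κ X) :=
  Measure.isProbabilityMeasure_map measurable_triple.aemeasurable

variable [Countable B] [DiscreteMeasurableSpace B]

lemma measurableSet_wordEvent {S : Type*} [MeasurableSpace S] {C : Set ((ℕ → A) × S)}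
    (hC : MeasurableSet C) (w : ℕ → B) (L : ℕ) : MeasurableSet (wordEvent C w L) :=
  ((measurable_fst.prodMk (measurable_fst.comp measurable_snd)) hC).inter
    ((measurable_snd.comp measurable_snd) (measurableSet_cyl w L))

/-- Over each rectangle of future inputs and states, the measures induced on the future output are
determined by cylinders. -/
lemma ext_of_wordEvent [Nonempty B] {S : Type*} [MeasurableSpace S]
    {μ ν : Measure ((ℕ → A) × (S × (ℕ → B)))} [IsFiniteMeasure μ]
    (h : ∀ C, MeasurableSet C → ∀ w L, μ (wordEvent C w L) = ν (wordEvent C w L)) : μ = ν := by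
  refine Measure.ext_prod₃ fun {D E F} hD hE hF => ?_
  have hR : ∀ G : Set (ℕ → B), D ×ˢ E ×ˢ G = (fun q : (ℕ → A) × (S × (ℕ → B)) => q.2.2) ⁻¹' G ∩
      D ×ˢ E ×ˢ Set.univ := by
    intro G
    ext q
    simp only [Set.mem_prod, Set.mem_inter_iff, Set.mem_preimage, Set.mem_univ, and_true]
    tauto
  have hY : Measurable fun q : (ℕ → A) × (S × (ℕ → B)) => q.2.2 := by fun_prop
  have happ : ∀ (ρ : Measure ((ℕ → A) × (S × (ℕ → B)))) {G : Set (ℕ → B)}, MeasurableSet G →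
      (ρ.restrict (D ×ˢ E ×ˢ Set.univ)).map (fun q => q.2.2) G = ρ (D ×ˢ E ×ˢ G) := by
    intro ρ G hG
    rw [Measure.map_apply hY hG, Measure.restrict_apply (hY hG), ← hR]
  rw [← happ μ hF, ← happ ν hF]
  congr 1
  refine ext_of_cyl fun w L => ?_
  rw [happ μ (measurableSet_cyl w L), happ ν (measurableSet_cyl w L)]
  have := h (D ×ˢ E) (hD.prod hE) w L
  have he : wordEvent (D ×ˢ E) w L = D ×ˢ E ×ˢ cyl w L := by
    ext q
    simp only [wordEvent, Set.mem_prod, Set.mem_ofPred_eq]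
    tauto
  rwa [he] at this

variable [Nonempty B] (κ : Kernel (ℤ → A) (ℤ → B)) [IsMarkovKernel κ]
  (X : ProbabilityMeasure (ℤ → A))

lemma tripleLaw_wordEvent {C : Set ((ℕ → A) × JointPast A B)} (hC : MeasurableSet C)
    (w : ℕ → B) (L : ℕ) : tripleLaw κ X (wordEvent C w L) =
      ∫⁻ p in C, futureMorph κ p.2 p.1 w L ∂(pastLaw κ X) := by
  rw [pastLaw, setLIntegral_futureMorph κ X w L hC, tripleLaw,
    Measure.map_apply measurable_triple (measurableSet_wordEvent hC w L)]
  rfl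

/-- The mass that the density `h (u, s, ·)` gives to a word. -/
noncomputable def wordMass {S : Type*} [MeasurableSpace S]
    (h : (ℕ → A) × (S × (ℕ → B)) → ℝ≥0∞) (w : ℕ → B) (L : ℕ) (p : (ℕ → A) × S) : ℝ≥0∞ :=
  ∫⁻ y in cyl w L, h (p.1, (p.2, y))
    ∂(condDistrib (fun ω => future ω.2) (fun ω => future ω.1) (jointProcess κ X) p.1)

lemma measurable_wordMass {S : Type*} [MeasurableSpace S]
    {h : (ℕ → A) × (S × (ℕ → B)) → ℝ≥0∞} (hh : Measurable h) (w : ℕ → B) (L : ℕ) :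
    Measurable (wordMass κ X h w L) := by
  set κY := condDistrib (fun ω : (ℤ → A) × (ℤ → B) => future ω.2) (fun ω => future ω.1)
    (jointProcess κ X)
  have := Measurable.setLIntegral_kernel_prod_right (κ := κY.comap Prod.fst measurable_fst)
      (f := fun (p : (ℕ → A) × S) y => h (p.1, (p.2, y)))
      (hh.comp (by fun_prop)) (measurableSet_cyl w L)
  exact this

variable [Countable A] [DiscreteMeasurableSpace A] [Nonempty A]

/-- The law under which the joint past and the future output are independent given the future
input. -/
noncomputable def refLaw : Measure ((ℕ → A) × (JointPast A B × (ℕ → B))) :=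
  (jointProcess κ X).map (fun ω => future ω.1) ⊗ₘ
    (condDistrib jointPast (fun ω => future ω.1) (jointProcess κ X) ×ₖ
      condDistrib (fun ω => future ω.2) (fun ω => future ω.1) (jointProcess κ X))

instance : IsProbabilityMeasure (refLaw κ X) := by
  have : IsProbabilityMeasure ((jointProcess κ X).map fun ω => future ω.1) :=
    Measure.isProbabilityMeasure_map (measurable_future.comp measurable_fst).aemeasurable
  unfold refLaw
  infer_instance

/-- All state maps are thereby measured on the same pair of laws, which turns prescience into a
question of data processing. -/
lemma prescience_eq {S : Type*} [MeasurableSpace S] {η : JointPast A B → S} (hη : Measurable η) :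
    prescience κ X η =
      klDiv ((tripleLaw κ X).map (mapState η)) ((refLaw κ X).map (mapState η)) := by
  have : IsProbabilityMeasure ((jointProcess κ X).map fun ω => future ω.1) :=
    Measure.isProbabilityMeasure_map (measurable_future.comp measurable_fst).aemeasurable
  have : IsMarkovKernel ((condDistrib jointPast (fun ω => future ω.1) (jointProcess κ X)).map η) :=
    Kernel.IsMarkovKernel.map _ hη
  unfold prescience
  congr 1
  · rw [tripleLaw, Measure.map_map (measurable_mapState hη) measurable_triple]
    rfl
  · ext s hs
    rw [Measure.map_apply (measurable_mapState hη) hs, refLaw, Measure.compProd_apply hs,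
      Measure.compProd_apply (measurable_mapState hη hs)]
    refine lintegral_congr fun u => ?_
    rw [Kernel.map_prod_eq _ _ hη, Kernel.map_apply' _
      (hη.prodMap measurable_id) _ (measurable_prodMk_left hs)]
    rfl

lemma prescience_id :
    prescience κ X (id : JointPast A B → JointPast A B) = klDiv (tripleLaw κ X) (refLaw κ X) := by
  have h : mapState (id : JointPast A B → JointPast A B) = id := rfl
  rw [prescience_eq κ X measurable_id, h, Measure.map_id, Measure.map_id]

/-- By conditional independence, one may draw future input and joint past together, then the future
output from the future input alone. -/
lemma lintegral_refLaw {h : (ℕ → A) × (JointPast A B × (ℕ → B)) → ℝ≥0∞} (hh : Measurable h) :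
    ∫⁻ q, h q ∂(refLaw κ X) = ∫⁻ p, ∫⁻ y, h (p.1, (p.2, y))
      ∂(condDistrib (fun ω => future ω.2) (fun ω => future ω.1) (jointProcess κ X) p.1)
        ∂(pastLaw κ X) := by
  have : IsProbabilityMeasure ((jointProcess κ X).map fun ω => future ω.1) :=
    Measure.isProbabilityMeasure_map (measurable_future.comp measurable_fst).aemeasurable
  set κY := condDistrib (fun ω : (ℤ → A) × (ℤ → B) => future ω.2) (fun ω => future ω.1)
    (jointProcess κ X)
  have hm : Measurable fun p : (ℕ → A) × JointPast A B => ∫⁻ y, h (p.1, (p.2, y)) ∂(κY p.1) :=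
    Measurable.lintegral_kernel_prod_right' (κ := κY.comap Prod.fst measurable_fst)
      (f := fun q : ((ℕ → A) × JointPast A B) × (ℕ → B) => h (q.1.1, (q.1.2, q.2)))
      (hh.comp (by fun_prop))
  rw [refLaw, Measure.lintegral_compProd hh, pastLaw, ← compProd_map_condDistrib (by fun_prop),
    Measure.lintegral_compProd hm]
  refine lintegral_congr fun u => ?_
  exact Kernel.lintegral_prod _ _ _ (hh.comp measurable_prodMk_left)

lemma withDensity_refLaw_wordEvent {h : (ℕ → A) × (JointPast A B × (ℕ → B)) → ℝ≥0∞}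
    (hh : Measurable h) {C : Set ((ℕ → A) × JointPast A B)} (hC : MeasurableSet C)
    (w : ℕ → B) (L : ℕ) : (refLaw κ X).withDensity h (wordEvent C w L) =
      ∫⁻ p in C, wordMass κ X h w L p ∂(pastLaw κ X) := by
  have hE := measurableSet_wordEvent hC w L
  rw [withDensity_apply _ hE, ← lintegral_indicator hE, lintegral_refLaw κ X (hh.indicator hE),
    ← lintegral_indicator hC]
  refine lintegral_congr fun p => ?_
  by_cases hp : p ∈ C
  · rw [Set.indicator_of_mem hp, wordMass, ← lintegral_indicator (measurableSet_cyl w L)]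
    refine lintegral_congr fun y => ?_
    by_cases hy : y ∈ cyl w L
    · rw [Set.indicator_of_mem hy, Set.indicator_of_mem (show _ ∈ wordEvent C w L from ⟨hp, hy⟩)]
    · rw [Set.indicator_of_notMem hy,
        Set.indicator_of_notMem (show _ ∉ wordEvent C w L from fun h => hy h.2)]
  · rw [Set.indicator_of_notMem hp]
    refine (lintegral_congr fun y => ?_).trans lintegral_zero
    rw [Set.indicator_of_notMem (show _ ∉ wordEvent C w L from fun h => hp h.1)]

/-- If the states determine the futures morph, they are prescient. -/
lemma prescience_eq_of_factors {S : Type*} [MeasurableSpace S] {η : JointPast A B → S}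
    (hη : Measurable η)
    (hG : ∀ (w : ℕ → B) (L : ℕ), ∃ G : (ℕ → A) × S → ℝ≥0∞, Measurable G ∧
      ∀ u z, futureMorph κ z u w L = G (u, η z)) :
    prescience κ X η = prescience κ X (id : JointPast A B → JointPast A B) := by
  have hT := measurable_mapState (A := A) (B := B) hη
  have hT' : Measurable (Prod.map id η : (ℕ → A) × JointPast A B → _) := measurable_id.prodMap hη
  rw [prescience_eq κ X hη, prescience_id]
  by_cases hac : (tripleLaw κ X).map (mapState η) ≪ (refLaw κ X).map (mapState η)
  swap
  · rw [klDiv_of_not_ac hac, klDiv_of_not_ac fun h => hac (h.map hT)]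
  set g := ((tripleLaw κ X).map (mapState η)).rnDeriv ((refLaw κ X).map (mapState η)) with hg
  have hgm : Measurable g := Measure.measurable_rnDeriv _ _
  have := Measure.isProbabilityMeasure_map (μ := tripleLaw κ X) hT.aemeasurable
  have := Measure.isProbabilityMeasure_map (μ := refLaw κ X) hT.aemeasurable
  have := Measure.isProbabilityMeasure_map (μ := pastLaw κ X) hT'.aemeasurable
  refine klDiv_map_eq_of_withDensity hT hgm (ext_of_wordEvent fun C hC w L => ?_)
  obtain ⟨G, hGm, hGf⟩ := hG w L
  -- On the state space both functions are conditional word probabilities given future input and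
  -- state. As `G` is the exact futures morph, the equality lifts to joint pasts and shows that `g ∘
  -- mapState η` is the density upstairs.
  have hae : G =ᵐ[(pastLaw κ X).map (Prod.map id η)] wordMass κ X g w L := by
    refine ae_eq_of_forall_setLIntegral_eq_of_sigmaFinite hGm (measurable_wordMass κ X hgm w L)
      fun C hC _ => ?_
    have h1 := congrArg (fun m => m (wordEvent C w L)) ((Measure.withDensity_rnDeriv_eq _ _ hac))
    simp only [← hg] at h1
    rw [← map_withDensity_comp hT hgm, Measure.map_apply hT (measurableSet_wordEvent hC w L),
      Measure.map_apply hT (measurableSet_wordEvent hC w L)] at h1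
    have h2 : mapState η ⁻¹' wordEvent C w L = wordEvent (Prod.map id η ⁻¹' C) w L := rfl
    rw [h2, withDensity_refLaw_wordEvent κ X (hgm.comp hT) (hT' hC),
      tripleLaw_wordEvent κ X (hT' hC)] at h1
    rw [setLIntegral_map hC hGm hT', setLIntegral_map hC (measurable_wordMass κ X hgm w L) hT']
    refine Eq.trans (lintegral_congr fun p => ?_) h1.symm
    exact (hGf p.1 p.2).symm
  rw [tripleLaw_wordEvent κ X hC, withDensity_refLaw_wordEvent κ X (hgm.comp hT) hC]
  refine lintegral_congr_ae (ae_restrict_of_ae ?_)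
  filter_upwards [ae_of_ae_map hT'.aemeasurable hae] with p hp
  rw [hGf p.1 p.2]
  exact hp

/-- Prescient states determine the futures morph almost surely, if the information that they share
with the future output is finite. -/
lemma exists_factor_of_prescience_eq {S : Type*} [MeasurableSpace S] {η : JointPast A B → S}
    (hη : Measurable η)
    (h : prescience κ X η = prescience κ X (id : JointPast A B → JointPast A B))
    (hfin : prescience κ X η ≠ ∞) (w : ℕ → B) (L : ℕ) :
    ∃ G : (ℕ → A) × S → ℝ≥0∞, Measurable G ∧
      ∀ᵐ p ∂(pastLaw κ X), futureMorph κ p.2 p.1 w L = G (p.1, η p.2) := by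
  have hT := measurable_mapState (A := A) (B := B) hη
  rw [h, prescience_id] at hfin
  rw [prescience_eq κ X hη, prescience_id] at h
  have heq := eq_withDensity_of_klDiv_map_eq hT h hfin
  set g := ((tripleLaw κ X).map (mapState η)).rnDeriv ((refLaw κ X).map (mapState η)) with hg
  have hgm : Measurable g := Measure.measurable_rnDeriv _ _
  refine ⟨wordMass κ X g w L, measurable_wordMass κ X hgm w L, ?_⟩
  refine ae_eq_of_forall_setLIntegral_eq_of_sigmaFinite (measurable_futureMorph κ w L)
    ((measurable_wordMass κ X hgm w L).comp (measurable_id.prodMap hη)) fun C hC _ => ?_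
  rw [← tripleLaw_wordEvent κ X hC, heq, withDensity_refLaw_wordEvent κ X (hgm.comp hT) hC]
  rfl

end Prescience

/-! ### Comparison of entropies -/

/-- If `F` is almost surely a function of `η`, then a variable `θ` whose classes are unions of
fibres of `F` has at most the entropy of `η`. -/
lemma shannonEntropy_map_le_of_ae_eq {Z S S' W : Type*} [MeasurableSpace Z] [StandardBorelSpace Z]
    [MeasurableSpace S] [MeasurableSpace S'] [MeasurableSpace W]
    [MeasurableSpace.CountablySeparated W] {π : Measure Z} [IsProbabilityMeasure π]
    {F : Z → W} (hF : Measurable F) {θ : Z → S'} (hθ : Measurable θ)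
    (hFθ : ∀ z z', F z = F z' → θ z = θ z') {η : Z → S} (hη : Measurable η) {H : S → W}
    (hH : Measurable H) (hae : F =ᵐ[π] H ∘ η) :
    shannonEntropy (π.map θ) ≤ shannonEntropy (π.map η) := by
  refine iSup₂_le fun n g => ?_
  have : Nonempty Z := nonempty_of_isProbabilityMeasure π
  have : MeasurableSpace.CountablySeparated (Set.range F) :=
    MeasurableSpace.Subtype.countablySeparated
  have : Nonempty (Fin n) := ⟨g.1 (θ (Classical.arbitrary Z))⟩
  have hgθ : Measurable[MeasurableSpace.comap F inferInstance] (g.1 ∘ θ) := by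
    refine @measurable_to_countable' _ _ _ _ (MeasurableSpace.comap F inferInstance) _ fun i => ?_
    -- Quotient σ-algebras may fail to be countably generated, so measurability is settled on the
    -- standard Borel space `Z`: a measurable set saturated for `F` is the preimage of a measurable
    -- set.
    have hsat : F ⁻¹' (F '' ((g.1 ∘ θ) ⁻¹' {i})) = (g.1 ∘ θ) ⁻¹' {i} := by
      refine Set.Subset.antisymm ?_ (Set.subset_preimage_image _ _)
      rintro z ⟨z', hz', hzz⟩
      have := hFθ z' z hzz
      simpa [this] using hz'
    have hm : MeasurableSet (F ⁻¹' (F '' ((g.1 ∘ θ) ⁻¹' {i}))) := by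
      rw [hsat]
      exact (g.2.comp hθ) (measurableSet_singleton i)
    obtain ⟨T, hT, hTe⟩ := hF.measurableSet_preimage_iff_preimage_val.1 hm
    refine ⟨T, hT, ?_⟩
    rw [← hsat]
    ext z
    exact Set.ext_iff.1 hTe ⟨F z, z, rfl⟩
  obtain ⟨g', hg', hgg⟩ := hgθ.exists_eq_measurable_comp
  refine le_iSup₂_of_le n ⟨g' ∘ H, hg'.comp hH⟩ (Finset.sum_le_sum fun i _ => le_of_eq ?_)
  congr 3
  simp only [Measure.real]
  congr 1
  rw [Measure.map_apply hθ (g.2 (measurableSet_singleton i)),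
    Measure.map_apply hη ((hg'.comp hH) (measurableSet_singleton i))]
  refine measure_congr ?_
  filter_upwards [hae] with z hz
  have h1 : g.1 (θ z) = g' (H (η z)) := (congrFun hgg z).trans (congrArg g' hz)
  exact congrArg (· = i) h1

/-- There is a probability measure that charges all points of a given countable family. -/
lemma exists_probabilityMeasure_charging {ι U : Type*} [Countable ι] [Nonempty ι]
    [MeasurableSpace U] [MeasurableSingletonClass U] (f : ι → U) :
    ∃ ρ : Measure U, IsProbabilityMeasure ρ ∧ ∀ p : U → Prop, (∀ᵐ u ∂ρ, p u) → ∀ i, p (f i) := by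
  let m : Measure U := Measure.sum fun i => Measure.dirac (f i)
  have hm : ∀ p : U → Prop, (∀ᵐ u ∂m, p u) → ∀ i, p (f i) := by
    intro p hp i
    have := Measure.ae_sum_iff.1 hp i
    rwa [ae_dirac_eq] at this
  have : NeZero m := ⟨fun h => hm (fun _ => False) (by simp [h]) (Classical.arbitrary ι)⟩
  exact ⟨m.toFinite, inferInstance, fun p hp => hm p (by rwa [ae_toFinite] at hp)⟩

section Channel

variable {A B : Type*} [MeasurableSpace A] [MeasurableSpace B]

/-! ### Coding the causal states by countably many word probabilities -/

/-- The futures morph on all finite words. -/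
noncomputable def morphCode [Nonempty A] [Nonempty B] (κ : Kernel (ℤ → A) (ℤ → B))
    (z : JointPast A B) (i : Σ L : ℕ, (Fin L → A) × (Fin L → B)) : ℝ≥0∞ :=
  futureMorph κ z (pad i.2.1) (pad i.2.2) i.1

lemma IsCausalChannel.futureMorph_eq_morphCode [Nonempty A] [Nonempty B] [Countable B]
    [DiscreteMeasurableSpace B] {κ : Kernel (ℤ → A) (ℤ → B)} (hκ : IsCausalChannel κ)
    (z : JointPast A B) (u : ℕ → A) (w : ℕ → B) (L : ℕ) :
    futureMorph κ z u w L = morphCode κ z ⟨L, (fun k => u k, fun k => w k)⟩ :=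
  hκ.futureMorph_congr (fun _ hk => (pad_apply u hk).symm) fun _ hk => (pad_apply w hk).symm

/-- Causality reduces all future inputs to finite words, of which there are countably many over
countable alphabets. Countably many null sets can then be discarded together. -/
lemma IsCausalChannel.causalEquiv_iff [Nonempty A] [Nonempty B] [Countable B]
    [DiscreteMeasurableSpace B] {κ : Kernel (ℤ → A) (ℤ → B)} (hκ : IsCausalChannel κ)
    (z z' : JointPast A B) : (causalEquiv κ).r z z' ↔ morphCode κ z = morphCode κ z' := by
  refine ⟨fun h => funext fun i => h _ _ _, fun h u w L => ?_⟩
  rw [hκ.futureMorph_eq_morphCode, hκ.futureMorph_eq_morphCode, h]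

/-- The law of the joint past. -/
noncomputable def jointPastLaw (κ : Kernel (ℤ → A) (ℤ → B)) (X : ProbabilityMeasure (ℤ → A)) :
    Measure (JointPast A B) := (jointProcess κ X).map jointPast

lemma statComplexity_eq (κ : Kernel (ℤ → A) (ℤ → B)) (X : ProbabilityMeasure (ℤ → A))
    (r : Setoid (JointPast A B)) :
    statComplexity κ X r = shannonEntropy ((jointPastLaw κ X).map (Quotient.mk r)) := by
  rw [jointPastLaw, Measure.map_map measurable_quotient_mk'' measurable_jointPast]
  rfl

variable (κ : Kernel (ℤ → A) (ℤ → B)) [IsMarkovKernel κ] (X : ProbabilityMeasure (ℤ → A))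

lemma measurable_morphCode [Nonempty A] [Nonempty B] [Countable B]
    [DiscreteMeasurableSpace B] : Measurable (morphCode κ) := by
  refine measurable_pi_lambda _ fun i => ?_
  have h := (measurable_futureMorph κ (pad i.2.2) i.1).comp
    (measurable_prodMk_left (x := (pad i.2.1 : ℕ → A)))
  simpa only [morphCode, Function.comp_def] using h

/-! ### Independent prolongation of an input past -/

instance : IsProbabilityMeasure (jointPastLaw κ X) :=
  Measure.isProbabilityMeasure_map measurable_jointPast.aemeasurable

/-- The process with the past of `X` and an independent future of law `ρ`. -/
noncomputable def prolong (ρ : Measure (ℕ → A)) [IsProbabilityMeasure ρ] :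
    ProbabilityMeasure (ℤ → A) :=
  ⟨(((X : Measure (ℤ → A)).map past).prod ρ).map fun q => glue q.1 q.2, by
    have : IsProbabilityMeasure ((X : Measure (ℤ → A)).map past) :=
      Measure.isProbabilityMeasure_map measurable_past.aemeasurable
    exact Measure.isProbabilityMeasure_map measurable_glue.aemeasurable⟩

variable (ρ : Measure (ℕ → A)) [IsProbabilityMeasure ρ]

lemma coe_prolong : (prolong X ρ : Measure (ℤ → A)) =
    (((X : Measure (ℤ → A)).map past).prod ρ).map fun q => glue q.1 q.2 := rfl

lemma map_past_prolong : (prolong X ρ : Measure (ℤ → A)).map past =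
    (X : Measure (ℤ → A)).map past := by
  rw [coe_prolong, Measure.map_map measurable_past measurable_glue]
  exact Measure.map_fst_prod.trans (by simp)

variable {X} in
lemma isStationaryPast_prolong (hX : IsStationaryProcess X) : IsStationaryPast (prolong X ρ) := by
  have hd : Measurable fun (p : ℕ → A) k => p (k + 1) := by fun_prop
  have hs : Measurable (shift : (ℤ → A) → _) :=
    measurable_pi_lambda _ fun t => measurable_pi_apply (t + 1)
  have e1 : ∀ Y : ProbabilityMeasure (ℤ → A),
      (Y : Measure (ℤ → A)).map (fun x k => past x (k + 1)) =
      ((Y : Measure (ℤ → A)).map past).map fun p k => p (k + 1) := fun Y =>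
    (Measure.map_map hd measurable_past).symm
  have e2 : (past : (ℤ → A) → _) = (fun x k => past x (k + 1)) ∘ shift := by
    funext x k
    simp only [past, shift, Function.comp]
    congr 1
  unfold IsStationaryPast
  rw [e1, map_past_prolong, ← e1]
  conv_rhs => rw [e2]
  have hm : Measurable fun (x : ℤ → A) k => past x (k + 1) := hd.comp measurable_past
  rw [← Measure.map_map hm hs, hX]

variable [Countable B] [DiscreteMeasurableSpace B] [Nonempty B]

variable {κ} in
/-- With an independent future input, the future input is independent of the joint past, whose law
does not depend on the future input. -/
lemma IsCausalChannel.pastLaw_prolong (hκ : IsCausalChannel κ) :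
    pastLaw κ (prolong X ρ) = ρ.prod (jointPastLaw κ X) := by
  have : IsProbabilityMeasure ((X : Measure (ℤ → A)).map past) :=
    Measure.isProbabilityMeasure_map measurable_past.aemeasurable
  have hne : Nonempty (ℕ → A) := nonempty_of_isProbabilityMeasure ρ
  let u₀ : ℕ → A := Classical.arbitrary _
  refine (Measure.prod_eq fun D E hD hE => ?_).symm
  -- By causality the law of the output past does not depend on the reference future `u₀`.
  let φ : (ℕ → A) → ℝ≥0∞ := fun p => κ (glue p u₀) {y | (p, past y) ∈ E}
  have hφ : Measurable φ := by
    have hg : Measurable fun p : ℕ → A => glue p u₀ :=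
      measurable_glue.comp (measurable_id.prodMk measurable_const)
    exact Kernel.measurable_kernel_prodMk_left (κ := κ.comap _ hg)
      (t := {q : (ℕ → A) × (ℤ → B) | (q.1, past q.2) ∈ E})
      ((measurable_fst.prodMk (measurable_past.comp measurable_snd)) hE)
  have hsec : ∀ p, MeasurableSet {q : ℕ → B | (p, q) ∈ E} := fun p => measurable_prodMk_left hE
  have hκφ : ∀ x, κ x {y | (past x, past y) ∈ E} = φ (past x) := by
    intro x
    have h := congrArg (fun m => m {q : ℕ → B | (past x, q) ∈ E})
      (hκ.map_past (x := x) (x' := glue (past x) u₀) rfl)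
    rw [Measure.map_apply measurable_past (hsec _),
      Measure.map_apply measurable_past (hsec _)] at h
    exact h
  have hE' : jointPastLaw κ X E = ∫⁻ p, φ p ∂((X : Measure (ℤ → A)).map past) := by
    rw [jointPastLaw, Measure.map_apply measurable_jointPast hE, jointProcess,
      Measure.compProd_apply (measurable_jointPast hE), lintegral_map hφ measurable_past]
    exact lintegral_congr hκφ
  have hDE : pastLaw κ (prolong X ρ) (D ×ˢ E) =
      ∫⁻ q, φ q.1 * D.indicator 1 q.2 ∂(((X : Measure (ℤ → A)).map past).prod ρ) := by
    have hm := measurable_pastPair (A := A) (B := B) (hD.prod hE)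
    rw [pastLaw, Measure.map_apply measurable_pastPair (hD.prod hE), jointProcess,
      Measure.compProd_apply hm, coe_prolong,
      lintegral_map (Kernel.measurable_kernel_prodMk_left hm) measurable_glue]
    refine lintegral_congr fun q => ?_
    by_cases hq : q.2 ∈ D
    · rw [Set.indicator_of_mem hq, Pi.one_apply, mul_one]
      refine Eq.trans (congrArg _ ?_) (hκφ (glue q.1 q.2))
      ext y
      exact and_iff_right hq
    · rw [Set.indicator_of_notMem hq, mul_zero]
      refine Eq.trans (congrArg _ ?_) measure_empty
      ext y
      exact iff_of_false (fun h => hq h.1) id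
  rw [hDE, lintegral_prod_mul hφ.aemeasurable (measurable_one.indicator hD).aemeasurable,
    lintegral_indicator_one hD, hE', mul_comm]

variable [Countable A] [DiscreteMeasurableSpace A] [Nonempty A]

variable {κ} in
/-- States of finite entropy share finite information with the future output, if the future input
is independent of the past. -/
lemma IsCausalChannel.prescience_prolong_ne_top (hκ : IsCausalChannel κ) {S : Type*}
    [MeasurableSpace S] {η : JointPast A B → S} (hη : Measurable η)
    (hent : shannonEntropy ((jointPastLaw κ X).map η) ≠ ∞) :
    prescience κ (prolong X ρ) η ≠ ∞ := by
  set P := jointProcess κ (prolong X ρ) with hP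
  let e : (ℕ → A) × (S × (ℕ → B)) ≃ᵐ S × ((ℕ → A) × (ℕ → B)) :=
    (MeasurableEquiv.prodAssoc.symm.trans
      (MeasurableEquiv.prodCongr MeasurableEquiv.prodComm (MeasurableEquiv.refl _))).trans
      MeasurableEquiv.prodAssoc
  have hT := measurable_mapState (A := A) (B := B) hη
  have heT : Measurable (e ∘ mapState η) := e.measurable.comp hT
  have := Measure.isProbabilityMeasure_map (μ := tripleLaw κ (prolong X ρ)) hT.aemeasurable
  have := Measure.isProbabilityMeasure_map (μ := refLaw κ (prolong X ρ)) hT.aemeasurable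
  have := Measure.isProbabilityMeasure_map (μ := (tripleLaw κ (prolong X ρ)).map (mapState η))
    e.measurable.aemeasurable
  have hpl := hκ.pastLaw_prolong X ρ
  have hfst : (((tripleLaw κ (prolong X ρ)).map (mapState η)).map e).map Prod.fst =
      (jointPastLaw κ X).map η := by
    have h1 : (pastLaw κ (prolong X ρ)).map Prod.snd = jointPastLaw κ X := by
      rw [hpl]; exact Measure.map_snd_prod.trans (by simp)
    rw [← h1, pastLaw, tripleLaw, Measure.map_map measurable_snd measurable_pastPair,
      Measure.map_map hη (measurable_snd.comp measurable_pastPair),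
      Measure.map_map hT measurable_triple,
      Measure.map_map e.measurable (hT.comp measurable_triple),
      Measure.map_map measurable_fst (e.measurable.comp (hT.comp measurable_triple))]
    rfl
  have hsnd : (((tripleLaw κ (prolong X ρ)).map (mapState η)).map e).map Prod.snd =
      ρ ⊗ₘ condDistrib (fun ω => future ω.2) (fun ω => future ω.1) P := by
    have h1 : P.map (fun ω => future ω.1) = ρ := by
      have h2 : (pastLaw κ (prolong X ρ)).map Prod.fst = ρ := by
        rw [hpl]; exact Measure.map_fst_prod.trans (by simp)
      rw [← h2, pastLaw, Measure.map_map measurable_fst measurable_pastPair]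
      rfl
    refine Eq.trans ?_
      (congrArg (· ⊗ₘ condDistrib (fun ω => future ω.2) (fun ω => future ω.1) P) h1)
    rw [compProd_map_condDistrib (Y := fun ω : (ℤ → A) × (ℤ → B) => future ω.2)
      (measurable_future.comp measurable_snd).aemeasurable, tripleLaw,
      Measure.map_map hT measurable_triple,
      Measure.map_map e.measurable (hT.comp measurable_triple),
      Measure.map_map measurable_snd (e.measurable.comp (hT.comp measurable_triple))]
    rfl
  -- Since the state is independent of the future input, the regrouped reference law is the product
  -- of the state's law and the joint law of both futures.
  have href : ((refLaw κ (prolong X ρ)).map (mapState η)).map e =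
      ((jointPastLaw κ X).map η).prod
        (ρ ⊗ₘ condDistrib (fun ω => future ω.2) (fun ω => future ω.1) P) := by
    refine (Measure.prod_eq fun E W hE hW => ?_).symm
    have hEW := heT (hE.prod hW)
    rw [Measure.map_map e.measurable hT, Measure.map_apply heT (hE.prod hW),
      Measure.map_apply hη hE, Measure.compProd_apply hW, ← lintegral_indicator_one hEW,
      lintegral_refLaw κ (prolong X ρ) (measurable_one.indicator hEW), hpl]
    rw [← lintegral_indicator_one (hη hE), mul_comm, ← lintegral_prod_mul
      (Kernel.measurable_kernel_prodMk_left hW).aemeasurable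
      (measurable_one.indicator (hη hE)).aemeasurable]
    refine lintegral_congr fun p => ?_
    by_cases hp : η p.2 ∈ E
    · rw [Set.indicator_of_mem (show p.2 ∈ η ⁻¹' E from hp), Pi.one_apply, mul_one,
        ← lintegral_indicator_one (measurable_prodMk_left hW)]
      refine lintegral_congr fun y => ?_
      refine Set.indicator_eq_indicator ?_ rfl
      exact and_iff_right hp
    · rw [Set.indicator_of_notMem (show p.2 ∉ η ⁻¹' E from hp), mul_zero]
      refine (lintegral_congr fun y => ?_).trans lintegral_zero
      exact Set.indicator_of_notMem (fun h => hp h.1) _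
  rw [prescience_eq κ _ hη, ← klDiv_map_measurableEquiv _ _ e, href, ← hsnd, ← hfst]
  refine klDiv_prod_ne_top _ ?_
  rwa [hfst]

variable {κ} in
lemma IsCausalChannel.isPrescient_causalEquiv (hκ : IsCausalChannel κ) :
    IsPrescient κ (causalEquiv κ) := by
  intro X _
  have hη : Measurable (Quotient.mk (causalEquiv κ)) := measurable_quotient_mk''
  refine prescience_eq_of_factors κ X hη fun w L => ?_
  have hker : ∀ z z' : JointPast A B, (causalEquiv κ).r z z' → morphCode κ z = morphCode κ z' :=
    fun z z' => (hκ.causalEquiv_iff z z').1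
  obtain ⟨F, hF, hFz⟩ : ∃ F : Quotient (causalEquiv κ) →
      (Σ L : ℕ, (Fin L → A) × (Fin L → B)) → ℝ≥0∞, Measurable F ∧
      ∀ z, F (Quotient.mk _ z) = morphCode κ z :=
    ⟨Quotient.lift (morphCode κ) hker, measurable_from_quotient.2 (measurable_morphCode κ),
      fun _ => rfl⟩
  refine ⟨fun p => F p.2 ⟨L, (fun k => p.1 k, fun k => w k)⟩, ?_, fun u z => ?_⟩
  swap
  · rw [hκ.futureMorph_eq_morphCode, ← hFz]
  -- Joint measurability is free here: the input enters through a word from a countable set.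
  have h1 : Measurable fun p : (Fin L → A) × Quotient (causalEquiv κ) =>
      F p.2 ⟨L, (p.1, fun k => w k)⟩ :=
    measurable_from_prod_countable_right fun a => measurable_pi_iff.1 hF ⟨L, (a, fun k => w k)⟩
  have h2 : Measurable fun p : (ℕ → A) × Quotient (causalEquiv κ) =>
      ((fun k : Fin L => p.1 k), p.2) := by fun_prop
  exact h1.comp h2

variable {κ X} in
/-- For each stationary input, the causal states minimise the statistical complexity among the
prescient partitions. -/
lemma IsCausalChannel.statComplexity_causalEquiv_le (hκ : IsCausalChannel κ)
    (hX : IsStationaryProcess X) {r : Setoid (JointPast A B)} (hr : IsPrescient κ r) :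
    statComplexity κ X (causalEquiv κ) ≤ statComplexity κ X r := by
  rw [statComplexity_eq, statComplexity_eq]
  have hη : Measurable (Quotient.mk r) := measurable_quotient_mk''
  by_cases hent : shannonEntropy ((jointPastLaw κ X).map (Quotient.mk r)) = ∞
  · rw [hent]; exact le_top
  obtain ⟨ρ, hρ, hcharge⟩ := exists_probabilityMeasure_charging
    fun i : Σ L : ℕ, Fin L → A => (pad i.2 : ℕ → A)
  have hfin := hκ.prescience_prolong_ne_top X ρ hη hent
  have hpre := hr _ (isStationaryPast_prolong ρ hX)
  have hfac : ∀ i : Σ L : ℕ, (Fin L → A) × (Fin L → B), ∃ H : Quotient r → ℝ≥0∞, Measurable H ∧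
      ∀ᵐ z ∂(jointPastLaw κ X), morphCode κ z i = H (Quotient.mk r z) := by
    intro i
    obtain ⟨G, hG, hae⟩ := exists_factor_of_prescience_eq κ (prolong X ρ) hη
      hpre hfin (pad i.2.2) i.1
    rw [hκ.pastLaw_prolong X ρ] at hae
    exact ⟨fun s => G (pad i.2.1, s), hG.comp measurable_prodMk_left,
      -- By Fubini the identity holds for `ρ`-almost every future input, hence at each padded word,
      -- since `ρ` charges it.
      hcharge _ (Measure.ae_ae_of_ae_prod hae) ⟨i.1, i.2.1⟩⟩
  choose H hH hae using hfac
  refine shannonEntropy_map_le_of_ae_eq (measurable_morphCode κ) measurable_quotient_mk''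
    (fun z z' h => Quotient.sound ((hκ.causalEquiv_iff z z').2 h)) hη
    (H := fun s i => H i s) (measurable_pi_lambda _ hH) ?_
  filter_upwards [ae_all_iff.2 hae] with z hz
  exact funext hz

end Channel

end Transducer

theorem mainTheorem12 {A B : Type*}
    [MeasurableSpace A] [Countable A] [DiscreteMeasurableSpace A] [Nonempty A]
    [MeasurableSpace B] [Countable B] [DiscreteMeasurableSpace B] [Nonempty B]
    (κ : Kernel (ℤ → A) (ℤ → B)) [IsMarkovKernel κ]
    (hstat : Transducer.IsStationaryChannel κ) (hcaus : Transducer.IsCausalChannel κ) :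
    Transducer.IsPrescient κ (Transducer.causalEquiv κ) ∧
      ∀ r : Setoid (Transducer.JointPast A B), Transducer.IsPrescient κ r →
        Transducer.channelComplexity κ (Transducer.causalEquiv κ) ≤
          Transducer.channelComplexity κ r :=
  ⟨hcaus.isPrescient_causalEquiv, fun _ hr =>
    iSup₂_mono fun _ hX => hcaus.statComplexity_causalEquiv_le hX hr⟩
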